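/- Let $L,\nu,\gamma,\Lambda,\xi>0$ and consider the three-dimensional Cahn--Hilliard--Navier--Stokes (CHNS) equations in a periodic box $\mathcal V=[0,L]^3$, $$(\partial_t+u\cdot\nabla)\phi=\gamma\Delta\mu,\qquad \mu=\Lambda\big[-\Delta\phi+\xi^{-2}(\phi^3-\phi)\big],$$ $$(\partial_t+u\cdot\nabla)u=\nu\Delta u-\phi\nabla\mu-\nabla p+f(x),\qquad \operatorname{div}u=0,$$ with a force $f(x)=F\,\Phi(x/L)$ of magnitude $F\ge 0$ and shape $\Phi$, where $\Phi$ is a smooth, $1$-periodic, divergence-free, mean-zero vector field. Let $(u,\phi,p)$ be a regular $L$-periodic solution on $[0,T^*)$, $0<T^*\le\infty$ (smooth for $0<t<T^*$, with $u,\phi,\nabla\phi$ continuous down to $t=0$). With $\langle h\rangle_T=\frac1T\int_0^T h\,d\tau$, put $$E=\int_{\mathcal V}\Big\{\tfrac{\Lambda}{2}|\nabla\phi|^2+\tfrac{\Lambda}{4\xi^2}(\phi^2-1)^2+\tfrac12|u|^2\Big\}dV,\qquad U^2=L^{-3}\langle\|u\|_2^2\rangle_T,$$ $$Gr=\frac{L^{3/2}\|f\|_2}{\nu^2},\qquad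 Re=\frac{UL}{\nu},\qquad \mathcal E(\nu,\gamma)=L^{-3}\Big\langle\int_{\mathcal V}\big(\nu|\nabla u|^2+\gamma|\nabla\mu|^2\big)dV\Big\rangle_T,\qquad \lambda_{\nu,\gamma}^{-1}=\Big(\frac{\mathcal E(\nu,\gamma)}{\nu^3}\Big)^{1/4}.$$ There is a constant $c>0$, depending only on the shape $\Phi$, such that for all such parameters, all $F$ and all such solutions the following hold. 1. For $0<t<T^*$, $\displaystyle \frac{dE}{dt}=-\int_{\mathcal V}\big(\nu|\nabla u|^2+\gamma|\nabla\mu|^2\big)dV+\int_{\mathcal V}u\cdot f\,dV .$ 2. For $0<T<T^*$ the dissipation $\int_{\mathcal V}(\nu|\nabla u|^2+\gamma|\nabla\mu|^2)\,dV$ is integrable in time over $(0,T)$, and $\mathcal E(\nu,\gamma)\le\nu^3L^{-4}\,Gr\,Re+O(T^{-1})$. 3. For $0<T<T^*$, $\displaystyle Gr\le c\,(Re+Re^2)+c\,\frac{\langle E\rangle_T}{L\nu^2}+O(T^{-1})$. 4. If $Gr$ is large, namely $Gr\ge c\,\big(1+\Lambda L^2/(\nu^2\xi^2)\big)$, then there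 is $T_0>0$ such that $L\lambda_{\nu,\gamma}^{-1}\le c\,Re^{3/4}$ for all $T$ with $T_0\le T<T^*$. The implied constants in $O(T^{-1})$, and $T_0$, may depend on the solution and the parameters but not on $T$. -/

import Mathlib

namespace CHNS

noncomputable section

/-- Points and vectors of three-dimensional space, in Cartesian coordinates. Euclidean lengths are
written out as sums of squares below. -/
abbrev Space : Type := Fin 3 → ℝ

/-- The partial derivative `∂ᵢ g`. -/
def pd (i : Fin 3) (g : Space → ℝ) (x : Space) : ℝ := fderiv ℝ g x (Pi.single i 1)

/-- The Laplacian `Δ g`. -/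
def lap (g : Space → ℝ) (x : Space) : ℝ := ∑ i, pd i (pd i g) x

/-- The divergence of a vector field. -/
def divergence (v : Space → Space) (x : Space) : ℝ := ∑ i, pd i (fun y => v y i) x

/-- `|∇ g|²` for a scalar field. -/
def gradSq (g : Space → ℝ) (x : Space) : ℝ := ∑ i, pd i g x ^ 2

/-- `|∇ v|²` for a vector field. -/
def gradSqVec (v : Space → Space) (x : Space) : ℝ := ∑ j, gradSq (fun y => v y j) x

/-- `|v|²`. -/
def normSq (v : Space) : ℝ := ∑ i, v i ^ 2

/-- Periodicity with period `L` in each coordinate direction. -/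
def IsPeriodic {α : Type} (L : ℝ) (g : Space → α) : Prop :=
  ∀ (i : Fin 3) (x : Space), g (x + Pi.single i L) = g x

/-- The periodic cell `[0, L]³`. -/
def box (L : ℝ) : Set Space := Set.Icc 0 (fun _ => L)

/-- The chemical potential `μ = Λ (-Δφ + ξ⁻² (φ³ - φ))`. -/
def chemPot (Lam ξ : ℝ) (φ : Space → ℝ) (x : Space) : ℝ :=
  Lam * (-(lap φ x) + (ξ ^ 2)⁻¹ * (φ x ^ 3 - φ x))

/-- The times `0 < t < Tmax`. -/
def openTimes (Tmax : EReal) : Set ℝ := {t | 0 < t ∧ (t : EReal) < Tmax}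

/-- The times `0 ≤ t < Tmax`. -/
def times (Tmax : EReal) : Set ℝ := {t | 0 ≤ t ∧ (t : EReal) < Tmax}

/-- A regular solution `(u, φ, p)` on `[0, Tmax)` of the three-dimensional
Cahn-Hilliard-Navier-Stokes equations in a periodic box of side `L`, driven by the
time-independent body force `f`: all fields are smooth for `0 < t < Tmax`, and `u`, `φ`, `∇φ`
are continuous down to `t = 0`. -/
structure IsSolution (L ν γ Lam ξ : ℝ) (f : Space → Space) (Tmax : EReal)
    (u : ℝ → Space → Space) (φ p : ℝ → Space → ℝ) : Prop where
  periodic_u : ∀ t ∈ times Tmax, IsPeriodic L (u t)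
  periodic_φ : ∀ t ∈ times Tmax, IsPeriodic L (φ t)
  periodic_p : ∀ t ∈ openTimes Tmax, IsPeriodic L (p t)
  smooth_u : ContDiffOn ℝ (⊤ : ℕ∞) (fun z : ℝ × Space => u z.1 z.2)
    (openTimes Tmax ×ˢ Set.univ)
  smooth_φ : ContDiffOn ℝ (⊤ : ℕ∞) (fun z : ℝ × Space => φ z.1 z.2)
    (openTimes Tmax ×ˢ Set.univ)
  smooth_p : ContDiffOn ℝ (⊤ : ℕ∞) (fun z : ℝ × Space => p z.1 z.2)
    (openTimes Tmax ×ˢ Set.univ)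
  continuous_u : ContinuousOn (fun z : ℝ × Space => u z.1 z.2) (times Tmax ×ˢ Set.univ)
  continuous_φ : ContinuousOn (fun z : ℝ × Space => φ z.1 z.2) (times Tmax ×ˢ Set.univ)
  differentiable_φ : ∀ t ∈ times Tmax, Differentiable ℝ (φ t)
  continuous_grad_φ : ∀ i, ContinuousOn (fun z : ℝ × Space => pd i (φ z.1) z.2)
    (times Tmax ×ˢ Set.univ)
  incompressible : ∀ t ∈ openTimes Tmax, ∀ x, divergence (u t) x = 0
  phase : ∀ t ∈ openTimes Tmax, ∀ x,
    deriv (fun s => φ s x) t + ∑ j, u t x j * pd j (φ t) x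
      = γ * lap (chemPot Lam ξ (φ t)) x
  momentum : ∀ t ∈ openTimes Tmax, ∀ x, ∀ i,
    deriv (fun s => u s x i) t + ∑ j, u t x j * pd j (fun y => u t y i) x
      = ν * lap (fun y => u t y i) x - φ t x * pd i (chemPot Lam ξ (φ t)) x
        - pd i (p t) x + f x i

/-- The shape of a force on the unit torus: a smooth, 1-periodic, divergence-free, mean-zero
vector field. -/
structure IsShape (Φ : Space → Space) : Prop where
  smooth : ContDiff ℝ (⊤ : ℕ∞) Φ
  periodic : IsPeriodic 1 Φ
  div_free : ∀ x, divergence Φ x = 0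
  mean_zero : ∀ i, ∫ x in box 1, Φ x i = 0

/-- The force `f(x) = F Φ(x / L)` of magnitude `F`, shape `Φ` and length scale `L`. -/
def force (F L : ℝ) (Φ : Space → Space) (x : Space) : Space := F • Φ (L⁻¹ • x)

/-- `‖v‖₂²` over the box. -/
def l2Sq (L : ℝ) (v : Space → Space) : ℝ := ∫ x in box L, normSq (v x)

/-- The energy
`E(t) = ∫ (Λ/2 |∇φ|² + Λ/(4ξ²) (φ² - 1)² + 1/2 |u|²) dV`. -/
def energy (L Lam ξ : ℝ) (u : ℝ → Space → Space) (φ : ℝ → Space → ℝ) (t : ℝ) : ℝ :=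
  ∫ x in box L, (Lam / 2 * gradSq (φ t) x + Lam / (4 * ξ ^ 2) * (φ t x ^ 2 - 1) ^ 2
    + 1 / 2 * normSq (u t x))

/-- The instantaneous dissipation `∫ (ν |∇u|² + γ |∇μ|²) dV`. -/
def dissipation (L ν γ Lam ξ : ℝ) (u : ℝ → Space → Space) (φ : ℝ → Space → ℝ) (t : ℝ) : ℝ :=
  ∫ x in box L, (ν * gradSqVec (u t) x + γ * gradSq (chemPot Lam ξ (φ t)) x)

/-- The power input `∫ u · f dV`. -/
def power (L : ℝ) (f : Space → Space) (u : ℝ → Space → Space) (t : ℝ) : ℝ :=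
  ∫ x in box L, ∑ i, u t x i * f x i

/-- The time average `⟨h⟩_T = T⁻¹ ∫₀ᵀ h dτ`. -/
def timeAvg (T : ℝ) (h : ℝ → ℝ) : ℝ := 1 / T * ∫ τ in (0 : ℝ)..T, h τ

/-- The energy-dissipation rate `L⁻³ ⟨∫ (ν |∇u|² + γ |∇μ|²) dV⟩_T`. -/
def dissipationRate (L ν γ Lam ξ : ℝ) (u : ℝ → Space → Space) (φ : ℝ → Space → ℝ) (T : ℝ) : ℝ :=
  (L ^ 3)⁻¹ * timeAvg T (dissipation L ν γ Lam ξ u φ)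

/-- The average velocity `U`, with `U² = L⁻³ ⟨‖u‖₂²⟩_T`. -/
def avgVelocity (L : ℝ) (u : ℝ → Space → Space) (T : ℝ) : ℝ :=
  Real.sqrt ((L ^ 3)⁻¹ * timeAvg T (fun t => l2Sq L (u t)))

/-- The Grashof number `Gr = L^{3/2} ‖f‖₂ / ν²`. -/
def grashof (L ν : ℝ) (f : Space → Space) : ℝ :=
  L ^ (3 / 2 : ℝ) * Real.sqrt (l2Sq L f) / ν ^ 2

/-- The Reynolds number `Re = U L / ν`. -/
def reynolds (L ν : ℝ) (u : ℝ → Space → Space) (T : ℝ) : ℝ := avgVelocity L u T * L / ν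

/-- The inverse Kolmogorov-like length `λ⁻¹ = (𝓔 / ν³)^{1/4}`. -/
def invKolmogorov (L ν γ Lam ξ : ℝ) (u : ℝ → Space → Space) (φ : ℝ → Space → ℝ) (T : ℝ) : ℝ :=
  (dissipationRate L ν γ Lam ξ u φ T / ν ^ 3) ^ (1 / 4 : ℝ)

end

end CHNS

/-!
All four claims follow from three integral balance laws, each obtained by writing the integrand of
a time derivative as a sum of divergences, whose integrals over the periodic cell vanish
(`integral_sum_pd_eq_zero`), and terms that are kept.

The energy balance is `IsSolution.hasDerivAt_energy`. Since the energy is continuous down to `t = 0`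
and the power is bounded there, the dissipation is integrable up to `t = 0`, and averaging in time
with the Cauchy-Schwarz inequality bounds the dissipation rate by `ν³ L⁻⁴ Gr Re`
(`IsSolution.timeAvg_dissipation_le`).

Testing the momentum equation with a steady divergence-free field `w`
(`IsSolution.hasDerivAt_integral_dot`) gives
`d/dt ∫ u · w = ∫ (u ⊗ u + Λ ∇φ ⊗ ∇φ) : ∇w + ν ∫ u · Δw + ∫ f · w`. With `w = f`, averaging in time
bounds `‖f‖₂²` by `U²`, `U` and the mean of `Λ ∫ |∇φ|²`, which is at most twice the mean energy. The
boundary terms are `O(1/T)` because the energy is bounded uniformly in time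
(`IsSolution.exists_energy_le`). That bound is Gronwall's inequality: by the Poincaré inequality,
and because the means of `u` (take `w` constant) and of `φ` are conserved, the energy is at most a
multiple of the dissipation plus a constant (`IsSolution.energy_le_dissipation`).

For large `Gr` the mean of `Λ ∫ |∇φ|²` has to be bounded by `Λ L³ / ξ²` with a constant that depends
neither on `γ` nor on the mean of `φ`. The dissipation does not give this, but the balance of
`∫ φ²` does: up to a time derivative, `∫ (ξ² (Δφ)² + (3 φ² - 1) |∇φ|²)` vanishes, and the deficit of
`3 φ² - 1` near `φ = 0` is made up by testing `Δφ` with the bounded function `arctan φ`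
(`IsSolution.integral_gradSq_φ_le`). Then `Gr ≤ C (Re + Re²) + C Λ L² / (ν² ξ²) + O(1/T)`, and when
`Gr` dominates the last two terms and a constant, `Re ≥ 1` and `Gr ≤ C Re²`. Inserted into
`𝓔 ≤ ν³ L⁻⁴ Gr Re + O(1/T)`, this is the bound on the inverse Kolmogorov-like length.
-/

open MeasureTheory Set Filter Topology
open scoped ContDiff

namespace CHNS

/-! ### Calculus of smooth periodic functions -/

/-- A smooth scalar field with period `L` in each coordinate direction. -/
structure SmoothPeriodic (L : ℝ) (g : Space → ℝ) : Prop where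
  smooth : ContDiff ℝ ∞ g
  periodic : IsPeriodic L g

section Pd

variable {g h : Space → ℝ} {i j : Fin 3} {x : Space}

lemma pd_const (c : ℝ) : pd i (fun _ => c) x = 0 := by simp [pd]

lemma pd_sub (hg : DifferentiableAt ℝ g x) (hh : DifferentiableAt ℝ h x) :
    pd i (fun y => g y - h y) x = pd i g x - pd i h x := by
  simp [pd, fderiv_fun_sub hg hh]

lemma pd_mul (hg : DifferentiableAt ℝ g x) (hh : DifferentiableAt ℝ h x) :
    pd i (fun y => g y * h y) x = pd i g x * h x + g x * pd i h x := by
  simp [pd, fderiv_fun_mul hg hh]; ring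

lemma pd_const_mul (c : ℝ) (hg : DifferentiableAt ℝ g x) :
    pd i (fun y => c * g y) x = c * pd i g x := by
  rw [pd_mul (differentiableAt_const c) hg, pd_const]; ring

lemma pd_sum {w : Fin 3 → Space → ℝ} (hw : ∀ j, DifferentiableAt ℝ (w j) x) :
    pd i (fun y => ∑ j, w j y) x = ∑ j, pd i (w j) x := by
  simp [pd, fderiv_fun_sum (fun j _ => hw j)]

lemma pd_comp {F : ℝ → ℝ} {F' : ℝ} (hF : HasDerivAt F F' (g x)) (hg : DifferentiableAt ℝ g x) :
    pd i (fun y => F (g y)) x = F' * pd i g x := by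
  have := (hF.comp_hasFDerivAt x hg.hasFDerivAt).fderiv
  unfold pd
  rw [show (fun y => F (g y)) = F ∘ g from rfl, this]
  simp

lemma contDiff_pd (hg : ContDiff ℝ ∞ g) : ContDiff ℝ ∞ (pd i g) := by
  unfold pd
  exact (hg.fderiv_right (m := ∞) (by simp)).clm_apply contDiff_const

end Pd

namespace IsPeriodic

variable {L : ℝ} {g : Space → ℝ}

lemma fderiv_periodic (hg : IsPeriodic L g) (i : Fin 3) (x : Space) :
    fderiv ℝ g (x + Pi.single i L) = fderiv ℝ g x := by
  rw [← fderiv_comp_add_right]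
  congr 1
  funext y
  exact hg i y

protected lemma pd (hg : IsPeriodic L g) (j : Fin 3) : IsPeriodic L (pd j g) := by
  intro i x
  simp only [CHNS.pd, hg.fderiv_periodic i x]

end IsPeriodic

namespace SmoothPeriodic

variable {L : ℝ} {g h : Space → ℝ}

lemma differentiableAt (hg : SmoothPeriodic L g) {x : Space} : DifferentiableAt ℝ g x :=
  (hg.smooth.differentiable (by simp)) x

lemma continuous (hg : SmoothPeriodic L g) : Continuous g := hg.smooth.continuous

lemma const (c : ℝ) : SmoothPeriodic L (fun _ => c) := ⟨contDiff_const, fun _ _ => rfl⟩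

lemma add (hg : SmoothPeriodic L g) (hh : SmoothPeriodic L h) :
    SmoothPeriodic L (fun x => g x + h x) :=
  ⟨hg.smooth.add hh.smooth, fun i x => by simp only [hg.periodic i x, hh.periodic i x]⟩

lemma sub (hg : SmoothPeriodic L g) (hh : SmoothPeriodic L h) :
    SmoothPeriodic L (fun x => g x - h x) :=
  ⟨hg.smooth.sub hh.smooth, fun i x => by simp only [hg.periodic i x, hh.periodic i x]⟩

lemma mul (hg : SmoothPeriodic L g) (hh : SmoothPeriodic L h) :
    SmoothPeriodic L (fun x => g x * h x) :=
  ⟨hg.smooth.mul hh.smooth, fun i x => by simp only [hg.periodic i x, hh.periodic i x]⟩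

lemma neg (hg : SmoothPeriodic L g) : SmoothPeriodic L (fun x => -g x) :=
  ⟨hg.smooth.neg, fun i x => by simp only [hg.periodic i x]⟩

lemma comp {F : ℝ → ℝ} (hF : ContDiff ℝ ∞ F) (hg : SmoothPeriodic L g) :
    SmoothPeriodic L (fun x => F (g x)) :=
  ⟨hF.comp hg.smooth, fun i x => by simp only [hg.periodic i x]⟩

lemma pow (hg : SmoothPeriodic L g) (n : ℕ) : SmoothPeriodic L (fun x => g x ^ n) :=
  ⟨hg.smooth.pow n, fun i x => by simp only [hg.periodic i x]⟩

lemma sum {w : Fin 3 → Space → ℝ} (hw : ∀ j, SmoothPeriodic L (w j)) :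
    SmoothPeriodic L (fun x => ∑ j, w j x) :=
  ⟨ContDiff.sum fun j _ => (hw j).smooth, fun i x => by simp only [(hw _).periodic i x]⟩

protected lemma pd (hg : SmoothPeriodic L g) (i : Fin 3) : SmoothPeriodic L (pd i g) :=
  ⟨contDiff_pd hg.smooth, hg.periodic.pd i⟩

protected lemma lap (hg : SmoothPeriodic L g) : SmoothPeriodic L (lap g) :=
  sum fun i => (hg.pd i).pd i

protected lemma gradSq (hg : SmoothPeriodic L g) : SmoothPeriodic L (gradSq g) :=
  sum fun i => (hg.pd i).pow 2

protected lemma chemPot (Lam ξ : ℝ) (hg : SmoothPeriodic L g) :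
    SmoothPeriodic L (chemPot Lam ξ g) :=
  (const Lam).mul (hg.lap.neg.add ((const _).mul ((hg.pow 3).sub hg)))

end SmoothPeriodic

/-! ### Integrals over the periodic cell -/

lemma isCompact_box (L : ℝ) : IsCompact (box L) := isCompact_Icc

lemma measurableSet_box (L : ℝ) : MeasurableSet (box L) := measurableSet_Icc

lemma integrableOn_box {L : ℝ} {g : Space → ℝ} (hg : Continuous g) : IntegrableOn g (box L) :=
  hg.continuousOn.integrableOn_compact (isCompact_box L)

lemma volume_real_box {L : ℝ} (hL : 0 ≤ L) : volume.real (box L) = L ^ 3 := by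
  have h : (0 : Space) ≤ fun _ => L := fun _ => hL
  rw [box, measureReal_def, Real.volume_Icc_pi_toReal h]
  simp

lemma integral_box_const {L : ℝ} (hL : 0 ≤ L) (c : ℝ) : ∫ _ in box L, c = L ^ 3 * c := by
  simp [volume_real_box hL]

lemma integral_box_add {L : ℝ} {g h : Space → ℝ} (hg : Continuous g) (hh : Continuous h) :
    ∫ x in box L, (g x + h x) = (∫ x in box L, g x) + ∫ x in box L, h x :=
  integral_add (integrableOn_box hg) (integrableOn_box hh)

lemma integral_box_sub {L : ℝ} {g h : Space → ℝ} (hg : Continuous g) (hh : Continuous h) :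
    ∫ x in box L, (g x - h x) = (∫ x in box L, g x) - ∫ x in box L, h x :=
  integral_sub (integrableOn_box hg) (integrableOn_box hh)

lemma integral_box_mono {L : ℝ} {g h : Space → ℝ} (hg : Continuous g) (hh : Continuous h)
    (hgh : ∀ x, g x ≤ h x) : ∫ x in box L, g x ≤ ∫ x in box L, h x :=
  setIntegral_mono (integrableOn_box hg) (integrableOn_box hh) hgh

/-- The divergence theorem on the periodic cell: the contributions of opposite faces cancel. -/
lemma integral_sum_pd_eq_zero {L : ℝ} (hL : 0 ≤ L) {J : Fin 3 → Space → ℝ}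
    (hJ : ∀ i, SmoothPeriodic L (J i)) : ∫ x in box L, ∑ i, pd i (J i) x = 0 := by
  have hle : (0 : Space) ≤ fun _ => L := fun _ => hL
  have key := integral_divergence_of_hasFDerivAt_off_countable' (0 : Space) (fun _ => L) hle
    J (fun i x => fderiv ℝ (J i) x) ∅ countable_empty
    (fun i => (hJ i).continuous.continuousOn)
    (fun x _ i => (hJ i).differentiableAt.hasFDerivAt)
    (integrableOn_box (SmoothPeriodic.sum fun i => (hJ i).pd i).continuous)
  refine key.trans (Finset.sum_eq_zero fun i _ => ?_)
  rw [sub_eq_zero]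
  refine integral_congr_ae (Eventually.of_forall fun x => ?_)
  have hx : (i.insertNth L x : Space) = i.insertNth (0 : ℝ) x + Pi.single i L := by
    rw [Fin.insertNth_eq_iff]
    constructor
    · simp
    · funext k
      simp [Fin.removeNth]
  change J i (i.insertNth L x) = J i (i.insertNth (0 : ℝ) x)
  rw [hx, (hJ i).periodic i]

/-! ### Fields smooth in space and time -/

/-- A time-dependent scalar field which is jointly smooth on `S ×ˢ univ`. -/
def SmoothField (S : Set ℝ) (G : ℝ → Space → ℝ) : Prop :=
  ContDiffOn ℝ ∞ (fun z : ℝ × Space => G z.1 z.2) (S ×ˢ univ)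

namespace SmoothField

variable {S : Set ℝ} {G H : ℝ → Space → ℝ} {t : ℝ} {x : Space}

lemma const_time {g : Space → ℝ} (hg : ContDiff ℝ ∞ g) : SmoothField S (fun _ => g) :=
  (hg.comp contDiff_snd).contDiffOn

lemma const (c : ℝ) : SmoothField S (fun _ _ => c) := contDiffOn_const

lemma add (hG : SmoothField S G) (hH : SmoothField S H) :
    SmoothField S (fun t x => G t x + H t x) := ContDiffOn.add hG hH

lemma sub (hG : SmoothField S G) (hH : SmoothField S H) :
    SmoothField S (fun t x => G t x - H t x) := ContDiffOn.sub hG hH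

lemma mul (hG : SmoothField S G) (hH : SmoothField S H) :
    SmoothField S (fun t x => G t x * H t x) := ContDiffOn.mul hG hH

lemma pow (hG : SmoothField S G) (n : ℕ) : SmoothField S (fun t x => G t x ^ n) :=
  ContDiffOn.pow hG n

lemma sum {W : Fin 3 → ℝ → Space → ℝ} (hW : ∀ j, SmoothField S (W j)) :
    SmoothField S (fun t x => ∑ j, W j t x) := ContDiffOn.sum fun j _ => hW j

lemma contDiffAt (hS : IsOpen S) (hG : SmoothField S G) (ht : t ∈ S) :
    ContDiffAt ℝ ∞ (fun z : ℝ × Space => G z.1 z.2) (t, x) :=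
  ContDiffOn.contDiffAt (s := S ×ˢ univ) hG ((hS.prod isOpen_univ).mem_nhds ⟨ht, mem_univ x⟩)

lemma differentiableAt (hS : IsOpen S) (hG : SmoothField S G) (ht : t ∈ S) :
    DifferentiableAt ℝ (fun z : ℝ × Space => G z.1 z.2) (t, x) :=
  (hG.contDiffAt hS ht).differentiableAt (by simp)

lemma slice (hG : SmoothField S G) (ht : t ∈ S) : ContDiff ℝ ∞ (G t) := by
  have : ContDiffOn ℝ ∞ ((fun z : ℝ × Space => G z.1 z.2) ∘ fun y : Space => (t, y)) univ :=
    ContDiffOn.comp hG (contDiff_const.prodMk contDiff_id).contDiffOn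
      fun y _ => ⟨ht, mem_univ y⟩
  exact contDiffOn_univ.1 this

lemma hasDerivAt_time (hS : IsOpen S) (hG : SmoothField S G) (ht : t ∈ S) (x : Space) :
    HasDerivAt (fun s => G s x)
      (fderiv ℝ (fun z : ℝ × Space => G z.1 z.2) (t, x) (1, 0)) t := by
  have h1 : HasDerivAt (fun s : ℝ => (s, x)) ((1, 0) : ℝ × Space) t :=
    (hasDerivAt_id t).prodMk (hasDerivAt_const t x)
  exact (hG.differentiableAt hS ht).hasFDerivAt.comp_hasDerivAt t h1

lemma deriv_eq (hS : IsOpen S) (hG : SmoothField S G) (ht : t ∈ S) (x : Space) :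
    deriv (fun s => G s x) t = fderiv ℝ (fun z : ℝ × Space => G z.1 z.2) (t, x) (1, 0) :=
  (hG.hasDerivAt_time hS ht x).deriv

lemma hasDerivAt (hS : IsOpen S) (hG : SmoothField S G) (ht : t ∈ S) (x : Space) :
    HasDerivAt (fun s => G s x) (deriv (fun s => G s x) t) t :=
  (hG.hasDerivAt_time hS ht x).differentiableAt.hasDerivAt

lemma pd_eq (hS : IsOpen S) (hG : SmoothField S G) (ht : t ∈ S) (x : Space) (i : Fin 3) :
    pd i (G t) x
      = fderiv ℝ (fun z : ℝ × Space => G z.1 z.2) (t, x) (0, Pi.single i 1) := by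
  have h1 : HasFDerivAt (fun y : Space => (t, y)) (ContinuousLinearMap.inr ℝ ℝ Space) x :=
    hasFDerivAt_prodMk_right t x
  have h2 : HasFDerivAt ((fun z : ℝ × Space => G z.1 z.2) ∘ fun y : Space => (t, y)) _ x :=
    HasFDerivAt.comp x (hG.differentiableAt hS ht (x := x)).hasFDerivAt h1
  change HasFDerivAt (G t) _ x at h2
  rw [pd, h2.fderiv]
  simp

lemma fderiv_apply (hS : IsOpen S) (hG : SmoothField S G) (v : ℝ × Space) :
    SmoothField S (fun t x => fderiv ℝ (fun z : ℝ × Space => G z.1 z.2) (t, x) v) :=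
  (ContDiffOn.fderiv_of_isOpen (m := ∞) hG (hS.prod isOpen_univ) (by simp)).clm_apply
    contDiffOn_const

protected lemma pd (hS : IsOpen S) (hG : SmoothField S G) (i : Fin 3) :
    SmoothField S (fun t => pd i (G t)) :=
  ContDiffOn.congr (hG.fderiv_apply hS (0, Pi.single i 1)) fun z hz => hG.pd_eq hS hz.1 z.2 i

lemma dt (hS : IsOpen S) (hG : SmoothField S G) :
    SmoothField S (fun t x => deriv (fun s => G s x) t) :=
  ContDiffOn.congr (hG.fderiv_apply hS (1, 0)) fun z hz => hG.deriv_eq hS hz.1 z.2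

protected lemma gradSq (hS : IsOpen S) (hG : SmoothField S G) :
    SmoothField S (fun t => gradSq (G t)) :=
  sum fun i => (hG.pd hS i).pow 2

/-- Time and space derivatives of a smooth field commute. -/
lemma hasDerivAt_pd (hS : IsOpen S) (hG : SmoothField S G) (ht : t ∈ S) (x : Space) (i : Fin 3) :
    HasDerivAt (fun s => pd i (G s) x) (pd i (fun y => deriv (fun s => G s y) t) x) t := by
  set Gt : ℝ × Space → ℝ := fun z => G z.1 z.2 with hGt
  have hsym : fderiv ℝ (fderiv ℝ Gt) (t, x) (1, 0) (0, Pi.single i 1)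
      = fderiv ℝ (fderiv ℝ Gt) (t, x) (0, Pi.single i 1) (1, 0) :=
    (ContDiffAt.isSymmSndFDerivAt (hG.contDiffAt hS ht (x := x))
      (by simpa using WithTop.coe_le_coe.2 (le_top : (2 : ℕ∞) ≤ ⊤))) _ _
  have hd2 : DifferentiableAt ℝ (fderiv ℝ Gt) (t, x) :=
    ((hG.contDiffAt hS ht (x := x)).fderiv_right (m := ∞) (by simp)).differentiableAt (by simp)
  have happ : ∀ v w : ℝ × Space,
      fderiv ℝ (fun z => fderiv ℝ Gt z v) (t, x) w = fderiv ℝ (fderiv ℝ Gt) (t, x) w v := by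
    intro v w
    have := (hd2.hasFDerivAt.clm_apply (hasFDerivAt_const v (t, x))).fderiv
    rw [this]; simp
  have h1 := (hG.pd hS i).hasDerivAt hS ht x
  convert h1 using 1
  have e1 : deriv (fun s => pd i (G s) x) t
      = deriv (fun s => fderiv ℝ Gt (s, x) (0, Pi.single i 1)) t := by
    refine Filter.EventuallyEq.deriv_eq ?_
    filter_upwards [hS.mem_nhds ht] with s hs using hG.pd_eq hS hs x i
  have e2 : (fun y => deriv (fun s => G s y) t) = fun y => fderiv ℝ Gt (t, y) (1, 0) :=
    funext fun y => hG.deriv_eq hS ht y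
  rw [e1, e2, (hG.fderiv_apply hS (0, Pi.single i 1)).deriv_eq hS ht x,
    (hG.fderiv_apply hS (1, 0)).pd_eq hS ht x i]
  simp only [Prod.mk.eta]
  rw [happ, happ, hsym]

/-- Differentiation under the integral over the (compact) periodic cell. -/
lemma hasDerivAt_integral (hS : IsOpen S) (hG : SmoothField S G) (ht : t ∈ S) (L : ℝ) :
    HasDerivAt (fun s => ∫ x in box L, G s x)
      (∫ x in box L, deriv (fun s => G s x) t) t := by
  obtain ⟨ε, hε, hball⟩ := Metric.nhds_basis_closedBall.mem_iff.1 (hS.mem_nhds ht)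
  have hK : IsCompact (Metric.closedBall t ε ×ˢ box L) :=
    (isCompact_closedBall t ε).prod (isCompact_box L)
  have hcont : ContinuousOn (fun z : ℝ × Space => deriv (fun s => G s z.2) z.1)
      (Metric.closedBall t ε ×ˢ box L) :=
    (ContDiffOn.continuousOn (hG.dt hS)).mono (prod_mono hball (subset_univ _))
  obtain ⟨C, hC⟩ := hK.exists_bound_of_continuousOn hcont
  refine (hasDerivAt_integral_of_dominated_loc_of_deriv_le (μ := volume.restrict (box L))
    (F := G) (F' := fun s x => deriv (fun r => G r x) s) (bound := fun _ => C)
    (Metric.closedBall_mem_nhds t hε) ?_ ?_ ?_ ?_ ?_ ?_).2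
  · filter_upwards [hS.mem_nhds ht] with s hs
    exact (hG.slice hs).continuous.aestronglyMeasurable
  · exact integrableOn_box (hG.slice ht).continuous
  · exact ((hG.dt hS).slice ht).continuous.aestronglyMeasurable
  · rw [ae_restrict_iff' (measurableSet_box L)]
    exact Eventually.of_forall fun x hx s hs => hC (s, x) ⟨hs, hx⟩
  · exact integrableOn_box continuous_const
  · exact Eventually.of_forall fun x s hs => hG.hasDerivAt hS (hball hs) x

end SmoothField

/-- The integral over the cell of a field continuous on `[a, b]` in time is continuous in time. -/
lemma continuousOn_integral_box {G : ℝ → Space → ℝ} {a b : ℝ}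
    (hG : ContinuousOn (fun z : ℝ × Space => G z.1 z.2) (Icc a b ×ˢ univ)) (L : ℝ) :
    ContinuousOn (fun t => ∫ x in box L, G t x) (Icc a b) := by
  rw [continuousOn_iff_continuous_domRestrict]
  have : Continuous (fun z : Icc a b × Space => G z.1 z.2) :=
    hG.comp_continuous (f := fun z : Icc a b × Space => ((z.1 : ℝ), z.2)) (by fun_prop)
      fun z => ⟨z.1.2, mem_univ _⟩
  exact continuous_parametric_integral_of_continuous (X := Icc a b)
    (f := fun t x => G t x) this (isCompact_box L)


/-! ### The Poincaré inequality on the periodic cell -/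

/-- Gronwall's inequality for `f' ≤ k (f - B)`, with `f` only continuous at the end points. -/
lemma sub_le_exp_mul_of_deriv_le {f f' : ℝ → ℝ} {k B T : ℝ} (hT : 0 ≤ T)
    (hf : ContinuousOn f (Icc 0 T)) (hf' : ∀ t ∈ Ioo 0 T, HasDerivAt f (f' t) t)
    (hle : ∀ t ∈ Ioo 0 T, f' t ≤ k * (f t - B)) :
    f T - B ≤ Real.exp (k * T) * (f 0 - B) := by
  have hd : ∀ t ∈ Ioo 0 T, HasDerivAt (fun s => Real.exp (-(k * s)) * (f s - B))
      (Real.exp (-(k * t)) * -(k * 1) * (f t - B) + Real.exp (-(k * t)) * f' t) t := fun t ht =>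
    (((hasDerivAt_id t).const_mul k).neg.exp).mul ((hf' t ht).sub_const B)
  have hanti : AntitoneOn (fun s => Real.exp (-(k * s)) * (f s - B)) (Icc 0 T) := by
    refine antitoneOn_of_deriv_nonpos (convex_Icc 0 T) ?_ ?_ ?_
    · exact ContinuousOn.mul (by fun_prop) (hf.sub continuousOn_const)
    · rw [interior_Icc]
      exact fun t ht => (hd t ht).differentiableAt.differentiableWithinAt
    · rw [interior_Icc]
      intro t ht
      rw [(hd t ht).deriv]
      have : Real.exp (-(k * t)) * (f' t - k * (f t - B)) ≤ 0 :=
        mul_nonpos_of_nonneg_of_nonpos (Real.exp_pos _).le (by linarith [hle t ht])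
      linarith
  have h := hanti (left_mem_Icc.2 hT) (right_mem_Icc.2 hT) hT
  simp only [mul_zero, neg_zero, Real.exp_zero, one_mul] at h
  calc f T - B = Real.exp (k * T) * (Real.exp (-(k * T)) * (f T - B)) := by
        rw [← mul_assoc, ← Real.exp_add]; simp
    _ ≤ _ := mul_le_mul_of_nonneg_left h (Real.exp_pos _).le

section Shift

variable {L : ℝ} {g : Space → ℝ}

lemma SmoothPeriodic.shift (hg : SmoothPeriodic L g) (h : Space) :
    SmoothPeriodic L (fun x => g (x + h)) :=
  ⟨hg.smooth.comp (contDiff_id.add contDiff_const), fun i x => by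
    rw [add_right_comm, hg.periodic i]⟩

lemma pd_shift (h : Space) (i : Fin 3) (x : Space) :
    pd i (fun y => g (y + h)) x = pd i g (x + h) := by
  simp only [pd, fderiv_comp_add_right]

lemma fderiv_apply_eq_sum (h x : Space) : fderiv ℝ g x h = ∑ i, h i * pd i g x := by
  conv_lhs => rw [pi_eq_sum_univ' h]
  simp [pd, map_sum]

/-- The field `(s, x) ↦ g (x + s h)`, whose parameter `s` slides `g` in the direction `h`. -/
def slide (g : Space → ℝ) (h : Space) (s : ℝ) (x : Space) : ℝ := g (x + s • h)

lemma smoothField_slide (hg : SmoothPeriodic L g) (h : Space) : SmoothField univ (slide g h) :=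
  ContDiff.contDiffOn (hg.smooth.comp (contDiff_snd.add (contDiff_fst.smul contDiff_const)))

lemma hasDerivAt_slide (hg : SmoothPeriodic L g) (h : Space) (s : ℝ) (x : Space) :
    HasDerivAt (fun r => slide g h r x) (∑ i, h i * pd i g (x + s • h)) s := by
  have h1 : HasDerivAt (fun r : ℝ => x + r • h) h s := by
    simpa using ((hasDerivAt_id s).smul_const h).const_add x
  rw [← fderiv_apply_eq_sum]
  exact (hg.differentiableAt.hasFDerivAt).comp_hasDerivAt s h1

/-- Translation invariance: the derivative of `∫ g (x + s h) dx` in `s` is the integral of a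
divergence. -/
lemma integral_shift (hL : 0 ≤ L) (hg : SmoothPeriodic L g) (h : Space) :
    ∫ x in box L, g (x + h) = ∫ x in box L, g x := by
  have hd : ∀ s, HasDerivAt (fun s => ∫ x in box L, slide g h s x) 0 s := by
    intro s
    have := (smoothField_slide hg h).hasDerivAt_integral isOpen_univ (mem_univ s) L
    convert this using 1
    rw [← integral_sum_pd_eq_zero hL (J := fun i x => h i * g (x + s • h))
      fun i => (SmoothPeriodic.const (h i)).mul (hg.shift _)]
    refine integral_congr_ae (Eventually.of_forall fun x => ?_)
    simp only
    rw [(hasDerivAt_slide hg h s x).deriv]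
    refine Finset.sum_congr rfl fun i _ => ?_
    rw [pd_const_mul _ (hg.shift _).differentiableAt, pd_shift]
  have := is_const_of_deriv_eq_zero (fun s => (hd s).differentiableAt) (fun s => (hd s).deriv) 1 0
  simpa [slide] using this

/-- `‖g(· + h) - g‖² ≤ 2 |h|² ‖∇g‖²`, from Gronwall's inequality for
`ψ(s) = ‖g(· + s h) - g‖²`, which satisfies `ψ' ≤ ψ + |h|² ‖∇g‖²`. -/
lemma integral_sq_shift_sub_le (hL : 0 ≤ L) (hg : SmoothPeriodic L g) (h : Space) :
    ∫ x in box L, (g (x + h) - g x) ^ 2 ≤ 2 * (∑ i, h i ^ 2) * ∫ x in box L, gradSq g x := by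
  set A : ℝ := (∑ i, h i ^ 2) * ∫ x in box L, gradSq g x with hA
  have hA0 : 0 ≤ A := mul_nonneg (Finset.sum_nonneg fun i _ => sq_nonneg _)
    (integral_nonneg fun x => Finset.sum_nonneg fun i _ => sq_nonneg _)
  have hF : SmoothField univ (fun s x => (slide g h s x - g x) ^ 2) :=
    ((smoothField_slide hg h).sub (.const_time hg.smooth)).pow 2
  have hd : ∀ s, HasDerivAt (fun s => ∫ x in box L, (slide g h s x - g x) ^ 2)
      (∫ x in box L, 2 * (slide g h s x - g x) * ∑ i, h i * pd i g (x + s • h)) s := by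
    intro s
    convert hF.hasDerivAt_integral isOpen_univ (mem_univ s) L using 1
    refine integral_congr_ae (Eventually.of_forall fun x => ?_)
    simp only
    rw [(((hasDerivAt_slide hg h s x).sub_const (g x)).fun_pow 2).deriv]
    simp
  have hslide : ∀ s, SmoothPeriodic L (slide g h s) := fun s => hg.shift _
  have hle : ∀ s, ∫ x in box L, 2 * (slide g h s x - g x) * ∑ i, h i * pd i g (x + s • h)
      ≤ 1 * ((∫ x in box L, (slide g h s x - g x) ^ 2) - (-A)) := by
    intro s
    have hsum : SmoothPeriodic L (fun x => ∑ i, h i * pd i g (x + s • h)) :=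
      .sum fun i => (SmoothPeriodic.const (h i)).mul ((hg.pd i).shift _)
    have hgs := hg.gradSq.shift (s • h)
    have h1 : A = ∫ x in box L, (∑ i, h i ^ 2) * gradSq g (x + s • h) := by
      rw [integral_const_mul, integral_shift hL hg.gradSq]
    rw [one_mul, sub_neg_eq_add, h1,
      ← integral_box_add (((hslide s).sub hg).pow 2).continuous
        ((SmoothPeriodic.const _).mul hgs).continuous]
    refine integral_box_mono
      (((SmoothPeriodic.const 2).mul ((hslide s).sub hg)).mul hsum).continuous
      ((((hslide s).sub hg).pow 2).add ((SmoothPeriodic.const _).mul hgs)).continuous fun x => ?_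
    have hcs := Finset.sum_mul_sq_le_sq_mul_sq Finset.univ h (fun i => pd i g (x + s • h))
    have := two_mul_le_add_sq (slide g h s x - g x) (∑ i, h i * pd i g (x + s • h))
    unfold gradSq
    linarith
  have := sub_le_exp_mul_of_deriv_le (k := 1) (B := -A) zero_le_one
    (fun s _ => (hd s).continuousAt.continuousWithinAt) (fun s _ => hd s) (fun s _ => hle s)
  simp only [slide, one_smul, zero_smul, add_zero, sub_self, mul_one] at this
  have he : Real.exp 1 ≤ 3 := by linarith [Real.exp_one_lt_d9]
  norm_num at this
  nlinarith

end Shift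

/-- The mean of a scalar field over the periodic cell. -/
noncomputable def mean (L : ℝ) (g : Space → ℝ) : ℝ := (L ^ 3)⁻¹ * ∫ x in box L, g x

lemma integral_sub_mean {L : ℝ} (hL : 0 < L) {g : Space → ℝ} (hg : Continuous g) :
    ∫ x in box L, (g x - mean L g) = 0 := by
  rw [integral_box_sub hg continuous_const, integral_box_const hL.le, mean]
  field_simp
  simp

/-- The Poincaré inequality, obtained by averaging `∫ (g(x + h) - g(x))² dx ≤ C |h|² ∫ |∇g|²`
over the shifts `h` in the cell. -/
lemma integral_sq_sub_mean_le {L : ℝ} (hL : 0 < L) {g : Space → ℝ} (hg : SmoothPeriodic L g) :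
    ∫ x in box L, (g x - mean L g) ^ 2 ≤ 3 * L ^ 2 * ∫ x in box L, gradSq g x := by
  have hD : 0 ≤ ∫ x in box L, gradSq g x :=
    integral_nonneg fun x => Finset.sum_nonneg fun i _ => sq_nonneg _
  have hI : ∀ h : Space, ∫ x in box L, (g (x + h) - g x) ^ 2
      = 2 * (∫ x in box L, g x ^ 2) - 2 * ∫ x in box L, g x * g (x + h) := by
    intro h
    have h2 := (hg.pow 2)
    have h1 := h2.shift h
    have h3 := (hg.mul (hg.shift h))
    have : ∀ x, (g (x + h) - g x) ^ 2
        = g (x + h) ^ 2 + g x ^ 2 - 2 * (g x * g (x + h)) := fun x => by ring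
    simp_rw [this]
    rw [integral_box_sub (h1.add h2).continuous ((SmoothPeriodic.const 2).mul h3).continuous,
      integral_box_add h1.continuous h2.continuous, integral_const_mul,
      integral_shift hL.le h2 h]
    ring
  have hcont : Continuous (fun z : Space × Space => g z.2 * g (z.2 + z.1)) := by
    have := hg.continuous
    fun_prop
  have hcorr : Continuous (fun h => ∫ x in box L, g x * g (x + h)) :=
    continuous_parametric_integral_of_continuous (f := fun h x => g x * g (x + h)) hcont
      (isCompact_box L)
  have hswap : ∫ h in box L, ∫ x in box L, g x * g (x + h) = (∫ x in box L, g x) ^ 2 := by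
    rw [integral_integral_swap]
    · have : ∀ x, ∫ h in box L, g x * g (x + h) = g x * ∫ h in box L, g h := by
        intro x
        rw [integral_const_mul]
        simp_rw [add_comm x]
        rw [integral_shift hL.le hg]
      simp_rw [this]
      rw [integral_mul_const, sq]
    · rw [Measure.prod_restrict]
      exact hcont.continuousOn.integrableOn_compact ((isCompact_box L).prod (isCompact_box L))
  have hle : ∫ h in box L, ∫ x in box L, (g (x + h) - g x) ^ 2
      ≤ ∫ h in box L, 6 * L ^ 2 * ∫ x in box L, gradSq g x := by
    refine setIntegral_mono_on ?_ (integrableOn_box continuous_const) (measurableSet_box L) ?_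
    · simp_rw [hI]
      exact integrableOn_box (continuous_const.sub (continuous_const.mul hcorr))
    · intro h hh
      refine (integral_sq_shift_sub_le hL.le hg h).trans (mul_le_mul_of_nonneg_right ?_ hD)
      have : ∀ i, h i ^ 2 ≤ L ^ 2 := fun i => pow_le_pow_left₀ (hh.1 i) (hh.2 i) 2
      have h0 := this 0
      have h1 := this 1
      have h2 := this 2
      rw [Fin.sum_univ_three]
      linarith
  simp_rw [hI] at hle
  rw [integral_box_sub (h := fun h => 2 * ∫ x in box L, g x * g (x + h)) continuous_const
    (continuous_const.mul hcorr), integral_box_const hL.le,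
    integral_box_const hL.le, integral_const_mul, hswap] at hle
  have hvar : ∫ x in box L, (g x - mean L g) ^ 2
      = (∫ x in box L, g x ^ 2) - (L ^ 3)⁻¹ * (∫ x in box L, g x) ^ 2 := by
    have : ∀ x, (g x - mean L g) ^ 2 = g x ^ 2 - 2 * mean L g * g x + mean L g ^ 2 :=
      fun x => by ring
    simp_rw [this]
    have h1 := (SmoothPeriodic.const (2 * mean L g)).mul hg
    rw [integral_box_add ((hg.pow 2).sub h1).continuous continuous_const,
      integral_box_sub (hg.pow 2).continuous h1.continuous, integral_const_mul,
      integral_box_const hL.le, mean]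
    field_simp
    ring
  rw [hvar]
  have hL3 : 0 < L ^ 3 := by positivity
  refine le_of_mul_le_mul_left ?_ (mul_pos two_pos hL3)
  have : 2 * L ^ 3 * ((∫ x in box L, g x ^ 2) - (L ^ 3)⁻¹ * (∫ x in box L, g x) ^ 2)
      = L ^ 3 * (2 * ∫ x in box L, g x ^ 2) - 2 * (∫ x in box L, g x) ^ 2 := by
    field_simp
  rw [this]
  linarith


/-! ### Total divergences -/

/-- Second partial derivatives of a smooth function commute. -/
lemma pd_comm {g : Space → ℝ} (hg : ContDiff ℝ ∞ g) (i j : Fin 3) (x : Space) :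
    pd i (pd j g) x = pd j (pd i g) x := by
  have hd : DifferentiableAt ℝ (fderiv ℝ g) x :=
    ((hg.fderiv_right (m := ∞) (by simp)).differentiable (by simp)) x
  have happ : ∀ v w : Space,
      fderiv ℝ (fun z => fderiv ℝ g z v) x w = fderiv ℝ (fderiv ℝ g) x w v := by
    intro v w
    rw [(hd.hasFDerivAt.clm_apply (hasFDerivAt_const v x)).fderiv]
    simp
  have hsym : IsSymmSndFDerivAt ℝ g x := ContDiffAt.isSymmSndFDerivAt hg.contDiffAt
    (by simpa using WithTop.coe_le_coe.2 (le_top : (2 : ℕ∞) ≤ ⊤))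
  change fderiv ℝ (fun z => fderiv ℝ g z (Pi.single j 1)) x (Pi.single i 1)
    = fderiv ℝ (fun z => fderiv ℝ g z (Pi.single i 1)) x (Pi.single j 1)
  rw [happ, happ, hsym]

/-- A smooth periodic field with vanishing integral over the cell. -/
structure ZeroIntegral (L : ℝ) (q : Space → ℝ) : Prop extends SmoothPeriodic L q where
  integral_eq : ∫ x in box L, q x = 0

namespace ZeroIntegral

variable {L : ℝ} {q r : Space → ℝ}

lemma add (hq : ZeroIntegral L q) (hr : ZeroIntegral L r) :
    ZeroIntegral L (fun x => q x + r x) :=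
  ⟨hq.toSmoothPeriodic.add hr.toSmoothPeriodic, by
    rw [integral_box_add hq.continuous hr.continuous, hq.integral_eq, hr.integral_eq, add_zero]⟩

lemma const_mul (hq : ZeroIntegral L q) (c : ℝ) : ZeroIntegral L (fun x => c * q x) :=
  ⟨(SmoothPeriodic.const c).mul hq.toSmoothPeriodic, by
    rw [integral_const_mul, hq.integral_eq, mul_zero]⟩

lemma sub (hq : ZeroIntegral L q) (hr : ZeroIntegral L r) :
    ZeroIntegral L (fun x => q x - r x) :=
  ⟨hq.toSmoothPeriodic.sub hr.toSmoothPeriodic, by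
    rw [integral_box_sub hq.continuous hr.continuous, hq.integral_eq, hr.integral_eq, sub_zero]⟩

lemma sum {w : Fin 3 → Space → ℝ} (hw : ∀ j, ZeroIntegral L (w j)) :
    ZeroIntegral L (fun x => ∑ j, w j x) := by
  simp only [Fin.sum_univ_three]
  exact ((hw 0).add (hw 1)).add (hw 2)

/-- `div (g ∇h) = ∇g · ∇h + g Δh` integrates to zero. -/
lemma grad_dot_add {g h : Space → ℝ} (hL : 0 ≤ L) (hg : SmoothPeriodic L g)
    (hh : SmoothPeriodic L h) :
    ZeroIntegral L (fun x => (∑ i, pd i g x * pd i h x) + g x * lap h x) := by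
  refine ⟨(SmoothPeriodic.sum fun i => (hg.pd i).mul (hh.pd i)).add (hg.mul hh.lap), ?_⟩
  rw [← integral_sum_pd_eq_zero hL (J := fun i x => g x * pd i h x) fun i => hg.mul (hh.pd i)]
  refine integral_congr_ae (Eventually.of_forall fun x => ?_)
  simp only [pd_mul hg.differentiableAt (hh.pd _).differentiableAt, lap, Finset.mul_sum,
    Finset.sum_add_distrib]

/-- `v · ∇g = div (g v)` integrates to zero when `div v = 0`. -/
lemma transport {v : Space → Space} {g : Space → ℝ} (hL : 0 ≤ L)
    (hv : ∀ i, SmoothPeriodic L (fun x => v x i)) (hdiv : ∀ x, divergence v x = 0)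
    (hg : SmoothPeriodic L g) :
    ZeroIntegral L (fun x => ∑ i, v x i * pd i g x) := by
  refine ⟨.sum fun i => (hv i).mul (hg.pd i), ?_⟩
  rw [← integral_sum_pd_eq_zero hL (J := fun i x => v x i * g x) fun i => (hv i).mul hg]
  refine integral_congr_ae (Eventually.of_forall fun x => ?_)
  simp only [pd_mul (hv _).differentiableAt hg.differentiableAt, Finset.sum_add_distrib,
    ← Finset.sum_mul]
  have := hdiv x
  unfold divergence at this
  rw [this, zero_mul, zero_add]

lemma integral_eq_of_sub_eq {a b : Space → ℝ} (hq : ZeroIntegral L q) (ha : Continuous a)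
    (hb : Continuous b) (h : ∀ x, a x - b x = q x) :
    ∫ x in box L, a x = ∫ x in box L, b x := by
  rw [← sub_eq_zero, ← integral_box_sub ha hb]
  simp_rw [h]
  exact hq.integral_eq

lemma integral_le_of_le_add {a b : Space → ℝ} (hq : ZeroIntegral L q) (ha : Continuous a)
    (hb : Continuous b) (h : ∀ x, a x ≤ b x + q x) :
    ∫ x in box L, a x ≤ ∫ x in box L, b x := by
  have := integral_box_mono (L := L) ha (hb.add hq.continuous) h
  simp only [Pi.add_apply] at this
  rwa [integral_box_add hb hq.continuous, hq.integral_eq, add_zero] at this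

end ZeroIntegral

/-! ### Regularity of solutions -/

lemma isOpen_openTimes (Tmax : EReal) : IsOpen (openTimes Tmax) :=
  (isOpen_lt continuous_const continuous_id).inter
    (isOpen_lt continuous_coe_real_ereal continuous_const)

namespace IsSolution

variable {L ν γ Lam ξ : ℝ} {f : Space → Space} {Tmax : EReal} {u : ℝ → Space → Space}
  {φ p : ℝ → Space → ℝ} {t : ℝ}

lemma mem_times (ht : t ∈ openTimes Tmax) : t ∈ times Tmax := ⟨ht.1.le, ht.2⟩

variable (hsol : IsSolution L ν γ Lam ξ f Tmax u φ p)
include hsol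

lemma smoothField_u (i : Fin 3) : SmoothField (openTimes Tmax) (fun t x => u t x i) :=
  contDiffOn_pi.1 hsol.smooth_u i

lemma smoothField_φ : SmoothField (openTimes Tmax) φ := hsol.smooth_φ

lemma smoothField_p : SmoothField (openTimes Tmax) p := hsol.smooth_p

lemma smoothPeriodic_u (ht : t ∈ openTimes Tmax) (i : Fin 3) :
    SmoothPeriodic L (fun x => u t x i) :=
  ⟨(hsol.smoothField_u i).slice ht, fun j x => by
    simp only [hsol.periodic_u t (mem_times ht) j x]⟩

lemma smoothPeriodic_φ (ht : t ∈ openTimes Tmax) : SmoothPeriodic L (φ t) :=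
  ⟨hsol.smoothField_φ.slice ht, hsol.periodic_φ t (mem_times ht)⟩

lemma smoothPeriodic_p (ht : t ∈ openTimes Tmax) : SmoothPeriodic L (p t) :=
  ⟨hsol.smoothField_p.slice ht, hsol.periodic_p t ht⟩

lemma smoothPeriodic_dt_φ (ht : t ∈ openTimes Tmax) :
    SmoothPeriodic L (fun x => deriv (fun s => φ s x) t) :=
  ⟨(hsol.smoothField_φ.dt (isOpen_openTimes _)).slice ht, fun i x => by
    refine Filter.EventuallyEq.deriv_eq ?_
    filter_upwards [(isOpen_openTimes _).mem_nhds ht] with s hs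
    exact hsol.periodic_φ s (mem_times hs) i x⟩

/-! ### Balance laws -/

/-- The energy balance. The transport terms, the pressure and the coupling
`μ u · ∇φ + φ u · ∇μ = u · ∇(μ φ)` are divergences. -/
lemma hasDerivAt_energy (hL : 0 ≤ L) (hf : ∀ i, Continuous (fun x => f x i))
    (ht : t ∈ openTimes Tmax) :
    HasDerivAt (energy L Lam ξ u φ) (-dissipation L ν γ Lam ξ u φ t + power L f u t) t := by
  have hS := isOpen_openTimes Tmax
  have hsφ := hsol.smoothField_φ
  have hφ := hsol.smoothPeriodic_φ ht
  have hu := hsol.smoothPeriodic_u ht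
  have hp := hsol.smoothPeriodic_p ht
  have hψ := hsol.smoothPeriodic_dt_φ ht
  have hμ := hφ.chemPot Lam ξ
  have hdiv := hsol.incompressible t ht
  have hG : SmoothField (openTimes Tmax) (fun t x => Lam / 2 * gradSq (φ t) x
      + Lam / (4 * ξ ^ 2) * (φ t x ^ 2 - 1) ^ 2 + 1 / 2 * normSq (u t x)) :=
    (((SmoothField.const _).mul (hsφ.gradSq hS)).add ((SmoothField.const _).mul
      (((hsφ.pow 2).sub (.const 1)).pow 2))).add ((SmoothField.const _).mul
        (.sum fun i => (hsol.smoothField_u i).pow 2))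
  have hdG := (hG.dt hS).slice ht
  refine (hG.hasDerivAt_integral hS ht L).congr_deriv ?_
  rw [neg_add_eq_sub]
  have hD : Continuous (fun x => ν * gradSqVec (u t) x + γ * gradSq (chemPot Lam ξ (φ t)) x) :=
    (((SmoothPeriodic.const ν).mul (.sum fun j => (hu j).gradSq)).add
      ((SmoothPeriodic.const γ).mul hμ.gradSq)).continuous
  have hP : Continuous (fun x => ∑ i, u t x i * f x i) :=
    continuous_finsetSum _ fun i _ => (hu i).continuous.mul (hf i)
  unfold power dissipation
  rw [← integral_box_sub hP hD]
  have hq : SmoothPeriodic L (fun x => 1 / 2 * ∑ j, u t x j ^ 2) :=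
    (SmoothPeriodic.const _).mul (.sum fun j => (hu j).pow 2)
  have hnull := ((((((ZeroIntegral.grad_dot_add hL hψ hφ).const_mul Lam).add
    ((ZeroIntegral.grad_dot_add hL hμ hμ).const_mul γ)).add
    ((ZeroIntegral.sum fun j => ZeroIntegral.grad_dot_add hL (hu j) (hu j)).const_mul ν)).sub
    (ZeroIntegral.transport hL hu hdiv (hμ.mul hφ))).sub
    (ZeroIntegral.transport hL hu hdiv hq)).sub
    (ZeroIntegral.transport hL hu hdiv hp)
  refine hnull.integral_eq_of_sub_eq hdG.continuous (hP.sub hD) fun x => ?_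
  have hd : deriv (fun s => Lam / 2 * gradSq (φ s) x
      + Lam / (4 * ξ ^ 2) * (φ s x ^ 2 - 1) ^ 2 + 1 / 2 * normSq (u s x)) t
      = Lam * (∑ i, pd i (φ t) x * pd i (fun y => deriv (fun s => φ s y) t) x)
        + Lam / ξ ^ 2 * (φ t x ^ 3 - φ t x) * deriv (fun s => φ s x) t
        + ∑ i, u t x i * deriv (fun s => u s x i) t := by
    have h1 := HasDerivAt.fun_sum (u := Finset.univ) fun i _ =>
      (hsφ.hasDerivAt_pd hS ht x i).fun_pow 2
    have h2 := (((hsφ.hasDerivAt hS ht x).fun_pow 2).sub_const 1).fun_pow 2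
    have h3 := HasDerivAt.fun_sum (u := Finset.univ) fun i _ =>
      ((hsol.smoothField_u i).hasDerivAt hS ht x).fun_pow 2
    have h4 := ((h1.const_mul (Lam / 2)).add (h2.const_mul (Lam / (4 * ξ ^ 2)))).add
      (h3.const_mul (1 / 2 : ℝ))
    refine h4.deriv.trans ?_
    simp only [Fin.sum_univ_three]
    push_cast
    ring
  rw [hd]
  have hqd : ∀ i, pd i (fun x => 1 / 2 * ∑ j, u t x j ^ 2) x
      = ∑ j, u t x j * pd i (fun y => u t y j) x := by
    intro i
    rw [pd_const_mul _ (SmoothPeriodic.sum fun j => (hu j).pow 2).differentiableAt,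
      pd_sum fun j => ((hu j).pow 2).differentiableAt]
    rw [Finset.mul_sum]
    refine Finset.sum_congr rfl fun j _ => ?_
    rw [pd_comp (F := fun s => s ^ 2) (hasDerivAt_pow 2 _) (hu j).differentiableAt]
    push_cast
    ring
  have hphase := hsol.phase t ht x
  have hmom := hsol.momentum t ht x
  have hm0 := hmom 0
  have hm1 := hmom 1
  have hm2 := hmom 2
  simp only [hqd, pd_mul hμ.differentiableAt hφ.differentiableAt]
  have hμx : chemPot Lam ξ (φ t) x
    = Lam * (-(lap (φ t) x) + (ξ ^ 2)⁻¹ * (φ t x ^ 3 - φ t x)) := rfl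
  generalize chemPot Lam ξ (φ t) = μ at *
  simp only [gradSqVec, gradSq, Fin.sum_univ_three] at *
  linear_combination (-deriv (fun s => φ s x) t) * hμx + μ x * hphase + u t x 0 * hm0
    + u t x 1 * hm1 + u t x 2 * hm2

/-- The momentum equation tested with a steady divergence-free field `w`. The capillary force is
`-φ ∇μ = Λ ∇ · (∇φ ⊗ ∇φ)` up to a gradient, so no derivative of `φ` beyond the first survives. -/
lemma hasDerivAt_integral_dot {w : Space → Space} (hL : 0 ≤ L)
    (hf : ∀ i, Continuous (fun x => f x i)) (hw : ∀ i, SmoothPeriodic L (fun x => w x i))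
    (hwdiv : ∀ x, divergence w x = 0) (ht : t ∈ openTimes Tmax) :
    HasDerivAt (fun s => ∫ x in box L, ∑ i, u s x i * w x i)
      (∫ x in box L, ((∑ i, ∑ j, u t x i * u t x j * pd j (fun y => w y i) x)
        + ν * (∑ i, u t x i * lap (fun y => w y i) x)
        + Lam * (∑ i, ∑ j, pd i (φ t) x * pd j (φ t) x * pd j (fun y => w y i) x)
        + ∑ i, f x i * w x i)) t := by
  have hS := isOpen_openTimes Tmax
  have hφ := hsol.smoothPeriodic_φ ht
  have hu := hsol.smoothPeriodic_u ht
  have hp := hsol.smoothPeriodic_p ht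
  have hμ := hφ.chemPot Lam ξ
  have hdiv := hsol.incompressible t ht
  have hG : SmoothField (openTimes Tmax) (fun t x => ∑ i, u t x i * w x i) :=
    .sum fun i => (hsol.smoothField_u i).mul (.const_time (hw i).smooth)
  have hdG := (hG.dt hS).slice ht
  refine (hG.hasDerivAt_integral hS ht L).congr_deriv ?_
  have hfw : Continuous (fun x => ∑ i, f x i * w x i) :=
    continuous_finsetSum _ fun i _ => (hf i).mul (hw i).continuous
  have hR : Continuous (fun x => (∑ i, ∑ j, u t x i * u t x j * pd j (fun y => w y i) x)
        + ν * (∑ i, u t x i * lap (fun y => w y i) x)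
        + Lam * (∑ i, ∑ j, pd i (φ t) x * pd j (φ t) x * pd j (fun y => w y i) x)
        + ∑ i, f x i * w x i) :=
    ((((SmoothPeriodic.sum fun i => .sum fun j => ((hu i).mul (hu j)).mul ((hw i).pd j)).add
      ((SmoothPeriodic.const ν).mul (.sum fun i => (hu i).mul (hw i).lap))).add
      ((SmoothPeriodic.const Lam).mul (.sum fun i => .sum fun j =>
        ((hφ.pd i).mul (hφ.pd j)).mul ((hw i).pd j)))).continuous).add hfw
  have huw : SmoothPeriodic L (fun x => ∑ i, u t x i * w x i) :=
    .sum fun i => (hu i).mul (hw i)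
  have hwφ : SmoothPeriodic L (fun x => ∑ i, w x i * pd i (φ t) x) :=
    .sum fun i => (hw i).mul (hφ.pd i)
  -- `Λ ξ⁻² (φ³ - φ) ∇φ` is the gradient of a function of `φ`
  have hQ : ContDiff ℝ ∞ (fun s : ℝ => Lam / ξ ^ 2 * (s ^ 4 / 4 - s ^ 2 / 2)) := by fun_prop
  have hgs : SmoothPeriodic L (fun x => 1 / 2 * ∑ j, pd j (φ t) x ^ 2) :=
    (SmoothPeriodic.const _).mul (.sum fun j => (hφ.pd j).pow 2)
  have hnull := ((((((((ZeroIntegral.sum fun i =>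
      ZeroIntegral.grad_dot_add hL (hw i) (hu i)).const_mul ν).sub
    ((ZeroIntegral.sum fun i => ZeroIntegral.grad_dot_add hL (hu i) (hw i)).const_mul ν)).sub
    (ZeroIntegral.transport hL hu hdiv huw)).sub
    (ZeroIntegral.transport hL hw hwdiv hp)).sub
    (ZeroIntegral.transport hL hw hwdiv (hφ.mul hμ))).add
    (ZeroIntegral.transport hL hw hwdiv (hφ.comp hQ))).sub
    ((ZeroIntegral.grad_dot_add hL hwφ hφ).const_mul Lam)).add
    ((ZeroIntegral.transport hL hw hwdiv hgs).const_mul Lam)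
  refine hnull.integral_eq_of_sub_eq hdG.continuous hR fun x => ?_
  have hd : deriv (fun s => ∑ i, u s x i * w x i) t
      = ∑ i, deriv (fun s => u s x i) t * w x i :=
    (HasDerivAt.fun_sum (u := Finset.univ) fun i _ =>
      ((hsol.smoothField_u i).hasDerivAt hS ht x).mul_const (w x i)).deriv
  rw [hd]
  have hgsd : ∀ i, pd i (fun x => 1 / 2 * ∑ j, pd j (φ t) x ^ 2) x
      = ∑ j, pd j (φ t) x * pd i (pd j (φ t)) x := by
    intro i
    rw [pd_const_mul _ (SmoothPeriodic.sum fun j => (hφ.pd j).pow 2).differentiableAt,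
      pd_sum fun j => ((hφ.pd j).pow 2).differentiableAt, Finset.mul_sum]
    refine Finset.sum_congr rfl fun j _ => ?_
    rw [pd_comp (F := fun s => s ^ 2) (hasDerivAt_pow 2 _) (hφ.pd j).differentiableAt]
    push_cast
    ring
  have hwφd : ∀ j, pd j (fun x => ∑ i, w x i * pd i (φ t) x) x
      = ∑ i, (pd j (fun y => w y i) x * pd i (φ t) x + w x i * pd j (pd i (φ t)) x) := by
    intro j
    rw [pd_sum fun i => ((hw i).mul (hφ.pd i)).differentiableAt]
    exact Finset.sum_congr rfl fun i _ =>
      pd_mul (hw i).differentiableAt (hφ.pd i).differentiableAt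
  have huwd : ∀ j, pd j (fun x => ∑ i, u t x i * w x i) x
      = ∑ i, (pd j (fun y => u t y i) x * w x i + u t x i * pd j (fun y => w y i) x) := by
    intro j
    rw [pd_sum fun i => ((hu i).mul (hw i)).differentiableAt]
    exact Finset.sum_congr rfl fun i _ =>
      pd_mul (hu i).differentiableAt (hw i).differentiableAt
  have hQd : ∀ i, pd i (fun x => Lam / ξ ^ 2 * (φ t x ^ 4 / 4 - φ t x ^ 2 / 2)) x
      = Lam / ξ ^ 2 * (φ t x ^ 3 - φ t x) * pd i (φ t) x := by
    intro i
    refine pd_comp (F := fun s => Lam / ξ ^ 2 * (s ^ 4 / 4 - s ^ 2 / 2)) ?_ hφ.differentiableAt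
    refine ((((hasDerivAt_pow 4 (φ t x)).div_const 4).sub
      ((hasDerivAt_pow 2 (φ t x)).div_const 2)).const_mul (Lam / ξ ^ 2)).congr_deriv ?_
    push_cast
    ring
  have hmom := hsol.momentum t ht x
  have hm0 := hmom 0
  have hm1 := hmom 1
  have hm2 := hmom 2
  simp only [hgsd, hwφd, huwd, hQd, pd_mul hφ.differentiableAt hμ.differentiableAt]
  have hμx : chemPot Lam ξ (φ t) x
    = Lam * (-(lap (φ t) x) + (ξ ^ 2)⁻¹ * (φ t x ^ 3 - φ t x)) := rfl
  have hc10 := pd_comm hφ.smooth 1 0 x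
  have hc20 := pd_comm hφ.smooth 2 0 x
  have hc21 := pd_comm hφ.smooth 2 1 x
  generalize chemPot Lam ξ (φ t) = μ at *
  simp only [Fin.sum_univ_three] at *
  rw [hc10, hc20, hc21]
  linear_combination w x 0 * hm0 + w x 1 * hm1 + w x 2 * hm2
    + (w x 0 * pd 0 (φ t) x + w x 1 * pd 1 (φ t) x + w x 2 * pd 2 (φ t) x) * hμx

/-- The phase field is conserved. -/
lemma hasDerivAt_integral_φ (hL : 0 ≤ L) (ht : t ∈ openTimes Tmax) :
    HasDerivAt (fun s => ∫ x in box L, φ s x) 0 t := by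
  have hS := isOpen_openTimes Tmax
  have hφ := hsol.smoothPeriodic_φ ht
  refine (hsol.smoothField_φ.hasDerivAt_integral hS ht L).congr_deriv ?_
  have hnull := ((ZeroIntegral.grad_dot_add hL (.const 1) (hφ.chemPot Lam ξ)).const_mul γ).sub
    (ZeroIntegral.transport hL (hsol.smoothPeriodic_u ht) (hsol.incompressible t ht) hφ)
  rw [← hnull.integral_eq]
  refine integral_congr_ae (Eventually.of_forall fun x => ?_)
  simp only [pd_const, zero_mul, Finset.sum_const_zero, one_mul, zero_add]
  linarith [hsol.phase t ht x]

lemma hasDerivAt_integral_sq_φ (ht : t ∈ openTimes Tmax) :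
    HasDerivAt (fun s => ∫ x in box L, φ s x ^ 2)
      (∫ x in box L, 2 * φ t x * deriv (fun s => φ s x) t) t := by
  have hS := isOpen_openTimes Tmax
  refine ((hsol.smoothField_φ.pow 2).hasDerivAt_integral hS ht L).congr_deriv ?_
  refine integral_congr_ae (Eventually.of_forall fun x => ?_)
  simp only
  rw [((hsol.smoothField_φ.hasDerivAt hS ht x).fun_pow 2).deriv]
  push_cast
  ring

/-- Testing the phase equation with `φ` gives
`d/dt ½ ∫ φ² = -γ Λ ∫ ((Δφ)² + ξ⁻² (3 φ² - 1) |∇φ|²)`. As `1 ≤ 2 / (1 + s²) + 3 s² - 1`, and as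
`2 |∇φ|² / (1 + φ²) = -2 (arctan φ) Δφ` up to a divergence with `arctan` bounded, this controls
`∫ |∇φ|²` by a constant independent of `γ`, up to a time derivative. -/
lemma integral_gradSq_φ_le (hL : 0 ≤ L) (hγ : 0 < γ) (hLam : 0 < Lam) (hξ : 0 < ξ)
    (ht : t ∈ openTimes Tmax) :
    ∫ x in box L, gradSq (φ t) x ≤ 3 * L ^ 3 / ξ ^ 2
      - ξ ^ 2 / (2 * γ * Lam) * ∫ x in box L, 2 * φ t x * deriv (fun s => φ s x) t := by
  have hφ := hsol.smoothPeriodic_φ ht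
  have hu := hsol.smoothPeriodic_u ht
  have hψ := hsol.smoothPeriodic_dt_φ ht
  have hμ := hφ.chemPot Lam ξ
  have hdiv := hsol.incompressible t ht
  have hat := hφ.comp (F := Real.arctan) Real.contDiff_arctan
  have hcub : ContDiff ℝ ∞ (fun s : ℝ => s ^ 3 - s) := by fun_prop
  have hsq : ContDiff ℝ ∞ (fun s : ℝ => s ^ 2 / 2) := by fun_prop
  have hnull := ((ZeroIntegral.grad_dot_add hL hat hφ).const_mul 2).add
    (((((ZeroIntegral.grad_dot_add hL hφ hμ).sub
      (ZeroIntegral.grad_dot_add hL hμ hφ)).const_mul (ξ ^ 2 / Lam)).add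
      (ZeroIntegral.grad_dot_add hL (hφ.comp hcub) hφ)).sub
      ((ZeroIntegral.transport hL hu hdiv (hφ.comp hsq)).const_mul (ξ ^ 2 / (γ * Lam))))
  have hφψ := ((SmoothPeriodic.const 2).mul hφ).mul hψ
  have hrhs : 3 * L ^ 3 / ξ ^ 2
      - ξ ^ 2 / (2 * γ * Lam) * ∫ x in box L, 2 * φ t x * deriv (fun s => φ s x) t
      = ∫ x in box L, (3 / ξ ^ 2
        - ξ ^ 2 / (2 * γ * Lam) * (2 * φ t x * deriv (fun s => φ s x) t)) := by
    rw [integral_box_sub continuous_const ((SmoothPeriodic.const _).mul hφψ).continuous,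
      integral_box_const hL, integral_const_mul]
    ring
  rw [hrhs]
  refine hnull.integral_le_of_le_add hφ.gradSq.continuous
    ((SmoothPeriodic.const _).sub ((SmoothPeriodic.const _).mul hφψ)).continuous fun x => ?_
  have hatd : ∀ i, pd i (fun x => Real.arctan (φ t x)) x
      = 1 / (1 + φ t x ^ 2) * pd i (φ t) x := fun i =>
    pd_comp (Real.hasDerivAt_arctan _) hφ.differentiableAt
  have hcubd : ∀ i, pd i (fun x => φ t x ^ 3 - φ t x) x
      = (3 * φ t x ^ 2 - 1) * pd i (φ t) x := by
    intro i
    refine pd_comp (F := fun s => s ^ 3 - s) ?_ hφ.differentiableAt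
    exact ((hasDerivAt_pow 3 (φ t x)).sub (hasDerivAt_id (φ t x))).congr_deriv (by push_cast; ring)
  have hsqd : ∀ i, pd i (fun x => φ t x ^ 2 / 2) x = φ t x * pd i (φ t) x := by
    intro i
    refine pd_comp (F := fun s => s ^ 2 / 2) ?_ hφ.differentiableAt
    exact ((hasDerivAt_pow 2 (φ t x)).div_const 2).congr_deriv (by push_cast; ring)
  have hphase := hsol.phase t ht x
  simp only [hatd, hcubd, hsqd]
  have hμx : chemPot Lam ξ (φ t) x
    = Lam * (-(lap (φ t) x) + (ξ ^ 2)⁻¹ * (φ t x ^ 3 - φ t x)) := rfl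
  generalize chemPot Lam ξ (φ t) = μ at *
  -- the phase equation and the definition of `μ` reduce the right-hand side to `|∇φ|²` times a
  -- factor at least `1`, plus a nonnegative quadratic expression in `Δφ`
  have hid : 3 / ξ ^ 2 - ξ ^ 2 / (2 * γ * Lam) * (2 * φ t x * deriv (fun s => φ s x) t)
      + (2 * ((∑ i, 1 / (1 + φ t x ^ 2) * pd i (φ t) x * pd i (φ t) x)
          + Real.arctan (φ t x) * lap (φ t) x)
        + (ξ ^ 2 / Lam * ((∑ i, pd i (φ t) x * pd i μ x) + φ t x * lap μ x
            - ((∑ i, pd i μ x * pd i (φ t) x) + μ x * lap (φ t) x))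
          + ((∑ i, (3 * φ t x ^ 2 - 1) * pd i (φ t) x * pd i (φ t) x)
            + (φ t x ^ 3 - φ t x) * lap (φ t) x)
          - ξ ^ 2 / (γ * Lam) * ∑ i, u t x i * (φ t x * pd i (φ t) x)))
      = (2 * (1 / (1 + φ t x ^ 2)) + (3 * φ t x ^ 2 - 1)) * gradSq (φ t) x
        + (3 / ξ ^ 2 + 2 * Real.arctan (φ t x) * lap (φ t) x + ξ ^ 2 * lap (φ t) x ^ 2) := by
    have hφt : deriv (fun s => φ s x) t = γ * lap μ x - ∑ j, u t x j * pd j (φ t) x := by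
      linarith
    rw [hφt, hμx]
    simp only [gradSq, Fin.sum_univ_three]
    field_simp
    ring
  rw [hid]
  have h1 : 1 ≤ 2 * (1 / (1 + φ t x ^ 2)) + (3 * φ t x ^ 2 - 1) := by
    have hpos : 0 < 1 + φ t x ^ 2 := by positivity
    have : 2 * (1 / (1 + φ t x ^ 2)) + (3 * φ t x ^ 2 - 1) - 1
        = (φ t x ^ 2 + 3 * (φ t x ^ 2) ^ 2) / (1 + φ t x ^ 2) := by
      field_simp
      ring
    have : 0 ≤ (φ t x ^ 2 + 3 * (φ t x ^ 2) ^ 2) / (1 + φ t x ^ 2) := by positivity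
    linarith
  have h2 : 0 ≤ gradSq (φ t) x := Finset.sum_nonneg fun i _ => sq_nonneg _
  have h3 : 0 ≤ 3 / ξ ^ 2 + 2 * Real.arctan (φ t x) * lap (φ t) x + ξ ^ 2 * lap (φ t) x ^ 2 := by
    have ha : Real.arctan (φ t x) ^ 2 ≤ 3 := by
      have h4 := Real.neg_pi_div_two_lt_arctan (φ t x)
      have h5 := Real.arctan_lt_pi_div_two (φ t x)
      have h6 := Real.pi_lt_d2
      nlinarith
    have : 3 / ξ ^ 2 + 2 * Real.arctan (φ t x) * lap (φ t) x + ξ ^ 2 * lap (φ t) x ^ 2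
        = (3 - Real.arctan (φ t x) ^ 2) / ξ ^ 2
          + (Real.arctan (φ t x) / ξ + ξ * lap (φ t) x) ^ 2 := by
      field_simp
      ring
    rw [this]
    have : 0 ≤ 3 - Real.arctan (φ t x) ^ 2 := by linarith
    positivity
  nlinarith

end IsSolution

/-! ### A bound on the energy uniform in time -/

lemma Icc_subset_times {Tmax : EReal} {T : ℝ} (hT : T ∈ times Tmax) : Icc 0 T ⊆ times Tmax :=
  fun _ ht => ⟨ht.1, (EReal.coe_le_coe_iff.2 ht.2).trans_lt hT.2⟩

lemma Ioo_subset_openTimes {Tmax : EReal} {T : ℝ} (hT : T ∈ times Tmax) :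
    Ioo 0 T ⊆ openTimes Tmax :=
  fun _ ht => ⟨ht.1, (EReal.coe_lt_coe_iff.2 ht.2).trans hT.2⟩

lemma eq_of_hasDerivAt_zero {f : ℝ → ℝ} {T : ℝ} (hT : 0 ≤ T) (hf : ContinuousOn f (Icc 0 T))
    (hf' : ∀ t ∈ Ioo 0 T, HasDerivAt f 0 t) : f T = f 0 := by
  have h1 := sub_le_exp_mul_of_deriv_le (k := 0) (B := 0) hT hf hf' (by simp)
  have h2 := sub_le_exp_mul_of_deriv_le (f := fun t => -f t) (k := 0) (B := 0) hT hf.neg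
    (fun t ht => (hf' t ht).neg) (by simp)
  simp at h1 h2
  linarith

namespace IsSolution

variable {L ν γ Lam ξ : ℝ} {f : Space → Space} {Tmax : EReal} {u : ℝ → Space → Space}
  {φ p : ℝ → Space → ℝ} {t T : ℝ} (hsol : IsSolution L ν γ Lam ξ f Tmax u φ p)

lemma continuous_slice {G : ℝ → Space → ℝ}
    (hG : ContinuousOn (fun z : ℝ × Space => G z.1 z.2) (times Tmax ×ˢ univ))
    (ht : t ∈ times Tmax) : Continuous (G t) :=
  hG.comp_continuous (f := fun x : Space => (t, x)) (by fun_prop) fun _ => ⟨ht, mem_univ _⟩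

lemma continuousOn_integral {G : ℝ → Space → ℝ}
    (hG : ContinuousOn (fun z : ℝ × Space => G z.1 z.2) (times Tmax ×ˢ univ))
    (hT : T ∈ times Tmax) : ContinuousOn (fun t => ∫ x in box L, G t x) (Icc 0 T) :=
  continuousOn_integral_box (hG.mono (prod_mono (Icc_subset_times hT) Subset.rfl)) L

include hsol

lemma continuousOn_u (i : Fin 3) :
    ContinuousOn (fun z : ℝ × Space => u z.1 z.2 i) (times Tmax ×ˢ univ) :=
  continuousOn_pi.1 hsol.continuous_u i

lemma continuousOn_normSq :
    ContinuousOn (fun z : ℝ × Space => normSq (u z.1 z.2)) (times Tmax ×ˢ univ) :=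
  continuousOn_finsetSum _ fun i _ => (hsol.continuousOn_u i).pow 2

lemma continuousOn_gradSq :
    ContinuousOn (fun z : ℝ × Space => gradSq (φ z.1) z.2) (times Tmax ×ˢ univ) :=
  continuousOn_finsetSum _ fun i _ => (hsol.continuous_grad_φ i).pow 2

lemma continuousOn_energyDensity :
    ContinuousOn (fun z : ℝ × Space => Lam / 2 * gradSq (φ z.1) z.2
      + Lam / (4 * ξ ^ 2) * (φ z.1 z.2 ^ 2 - 1) ^ 2 + 1 / 2 * normSq (u z.1 z.2))
      (times Tmax ×ˢ univ) :=
  ((continuousOn_const.mul hsol.continuousOn_gradSq).add (continuousOn_const.mul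
    (((hsol.continuous_φ.pow 2).sub continuousOn_const).pow 2))).add
    (continuousOn_const.mul hsol.continuousOn_normSq)

lemma continuousOn_dot {w : Space → Space} (hw : ∀ i, Continuous (fun x => w x i)) :
    ContinuousOn (fun z : ℝ × Space => ∑ i, u z.1 z.2 i * w z.2 i) (times Tmax ×ˢ univ) :=
  continuousOn_finsetSum _ fun i _ =>
    (hsol.continuousOn_u i).mul ((hw i).comp continuous_snd).continuousOn

lemma continuousOn_energy (hT : T ∈ times Tmax) :
    ContinuousOn (energy L Lam ξ u φ) (Icc 0 T) :=
  continuousOn_integral hsol.continuousOn_energyDensity hT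

lemma mean_φ_eq (hL : 0 ≤ L) (hT : T ∈ times Tmax) : mean L (φ T) = mean L (φ 0) := by
  unfold mean
  congr 1
  exact eq_of_hasDerivAt_zero hT.1 (continuousOn_integral hsol.continuous_φ hT)
    fun t ht => hsol.hasDerivAt_integral_φ hL (Ioo_subset_openTimes hT ht)

/-- A mean-zero force conserves momentum: the momentum equation is tested with constants. -/
lemma mean_u_eq (hL : 0 ≤ L) (hf : ∀ i, Continuous (fun x => f x i))
    (hf0 : ∀ i, ∫ x in box L, f x i = 0) (hT : T ∈ times Tmax) (i : Fin 3) :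
    mean L (fun x => u T x i) = mean L (fun x => u 0 x i) := by
  unfold mean
  congr 1
  refine eq_of_hasDerivAt_zero (f := fun t => ∫ x in box L, u t x i) hT.1
    (continuousOn_integral (G := fun t x => u t x i) (hsol.continuousOn_u i) hT) fun t ht => ?_
  have hw : ∀ j : Fin 3, SmoothPeriodic L (fun _ => (Pi.single i 1 : Space) j) :=
    fun j => .const _
  have := hsol.hasDerivAt_integral_dot (w := fun _ => Pi.single i 1) hL hf hw
    (fun x => by simp [divergence, pd_const]) (Ioo_subset_openTimes hT ht)
  have hpd : ∀ (j : Fin 3) (c : ℝ), pd j (fun _ => c) = fun _ => 0 :=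
    fun j c => funext fun x => pd_const c
  have hlap : ∀ (c : ℝ) (x : Space), lap (fun _ => c) x = 0 := by simp [lap, hpd]
  simp only [hlap, hpd] at this
  simpa [Pi.single_apply, hf0] using this

omit hsol in
lemma freeEnergyDensity_nonneg (hLam : 0 ≤ Lam) (x : Space) : 0 ≤ Lam / 2 * gradSq (φ t) x
    + Lam / (4 * ξ ^ 2) * (φ t x ^ 2 - 1) ^ 2 := by
  have : 0 ≤ gradSq (φ t) x := Finset.sum_nonneg fun i _ => sq_nonneg _
  positivity

omit hsol in
lemma energy_nonneg (hLam : 0 ≤ Lam) : 0 ≤ energy L Lam ξ u φ t :=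
  integral_nonneg fun x => add_nonneg (freeEnergyDensity_nonneg hLam x)
    (mul_nonneg (by norm_num) (Finset.sum_nonneg fun i _ => sq_nonneg _))

lemma l2Sq_le_energy (hLam : 0 ≤ Lam) (ht : t ∈ times Tmax) :
    l2Sq L (u t) ≤ 2 * energy L Lam ξ u φ t := by
  unfold l2Sq energy
  rw [← integral_const_mul]
  refine integral_box_mono (continuous_slice (G := fun t x => normSq (u t x))
    hsol.continuousOn_normSq ht)
    (continuous_const.mul (continuous_slice (G := fun t x => Lam / 2 * gradSq (φ t) x
      + Lam / (4 * ξ ^ 2) * (φ t x ^ 2 - 1) ^ 2 + 1 / 2 * normSq (u t x))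
      hsol.continuousOn_energyDensity ht)) fun x => ?_
  have := freeEnergyDensity_nonneg (φ := φ) (t := t) (ξ := ξ) hLam x
  linarith

lemma integral_gradSq_le_energy (hLam : 0 ≤ Lam) (ht : t ∈ times Tmax) :
    Lam * ∫ x in box L, gradSq (φ t) x ≤ 2 * energy L Lam ξ u φ t := by
  unfold energy
  rw [← integral_const_mul, ← integral_const_mul]
  refine integral_box_mono (continuous_const.mul (continuous_slice
    (G := fun t x => gradSq (φ t) x) hsol.continuousOn_gradSq ht))
    (continuous_const.mul (continuous_slice (G := fun t x => Lam / 2 * gradSq (φ t) x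
      + Lam / (4 * ξ ^ 2) * (φ t x ^ 2 - 1) ^ 2 + 1 / 2 * normSq (u t x))
      hsol.continuousOn_energyDensity ht)) fun x => ?_
  have h1 : 0 ≤ Lam / (4 * ξ ^ 2) * (φ t x ^ 2 - 1) ^ 2 := by positivity
  have h2 : 0 ≤ normSq (u t x) := Finset.sum_nonneg fun i _ => sq_nonneg _
  linarith

/-- The energy is controlled by the dissipation and the conserved means. The potential energy is
estimated by testing `μ` with `φ - mean φ`, and `∫ (μ - mean μ) (φ - mean φ)` by the Poincaré
inequality for both factors. -/
lemma energy_le_dissipation (hL : 0 < L) (hν : 0 < ν) (hγ : 0 < γ) (hLam : 0 < Lam)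
    (ht : t ∈ openTimes Tmax) :
    energy L Lam ξ u φ t
      ≤ (9 * L ^ 4 / (2 * Lam * γ) + 3 * L ^ 2 / ν) * dissipation L ν γ Lam ξ u φ t
        + L ^ 3 * (Lam / ξ ^ 2 * ((1 + mean L (φ t) ^ 2) ^ 2 / 2 + mean L (φ t) ^ 2 / 2 + 1 / 4)
          + ∑ i, mean L (fun x => u t x i) ^ 2) := by
  have hφ := hsol.smoothPeriodic_φ ht
  have hu := hsol.smoothPeriodic_u ht
  have hμ := hφ.chemPot Lam ξ
  set a := mean L (φ t) with ha
  set b := mean L (chemPot Lam ξ (φ t)) with hb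
  set m : Fin 3 → ℝ := fun i => mean L (fun x => u t x i) with hm
  have hφa : SmoothPeriodic L (fun x => φ t x - a) := hφ.sub (.const a)
  have hμb : SmoothPeriodic L (fun x => chemPot Lam ξ (φ t) x - b) := hμ.sub (.const b)
  have hum : ∀ i, SmoothPeriodic L (fun x => u t x i - m i) := fun i => (hu i).sub (.const _)
  have hz : ZeroIntegral L (fun x => φ t x - a) := ⟨hφa, integral_sub_mean hL hφ.continuous⟩
  have hnull := ((ZeroIntegral.grad_dot_add hL.le hφa hφ).const_mul Lam).add (hz.const_mul b)
  set c := Lam / ξ ^ 2 * ((1 + a ^ 2) ^ 2 / 2 + a ^ 2 / 2 + 1 / 4) + ∑ i, m i ^ 2 with hc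
  have h1 := (SmoothPeriodic.const (Lam / (6 * L ^ 2))).mul (hφa.pow 2)
  have h2 := (SmoothPeriodic.const (Lam / 2)).mul hφ.gradSq
  have h3 := (SmoothPeriodic.const (3 * L ^ 2 / (2 * Lam))).mul (hμb.pow 2)
  have h4 : ∀ i, SmoothPeriodic L (fun x => (u t x i - m i) ^ 2) := fun i => (hum i).pow 2
  have hbound : energy L Lam ξ u φ t ≤ ∫ x in box L,
      (c + (Lam / (6 * L ^ 2) * (φ t x - a) ^ 2 - Lam / 2 * gradSq (φ t) x)
        + 3 * L ^ 2 / (2 * Lam) * (chemPot Lam ξ (φ t) x - b) ^ 2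
        + ∑ i, (u t x i - m i) ^ 2) := by
    refine hnull.integral_le_of_le_add
      (continuous_slice (G := fun t x => Lam / 2 * gradSq (φ t) x
        + Lam / (4 * ξ ^ 2) * (φ t x ^ 2 - 1) ^ 2 + 1 / 2 * normSq (u t x))
        hsol.continuousOn_energyDensity (mem_times ht))
      (((((SmoothPeriodic.const c).add (h1.sub h2)).add h3)).add (.sum h4)).continuous
      fun x => ?_
    have hpd : ∀ i, pd i (fun x => φ t x - a) x = pd i (φ t) x := by
      intro i
      rw [pd_sub hφ.differentiableAt (differentiableAt_const a), pd_const, sub_zero]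
    simp only [hpd]
    have hg : ∑ i, pd i (φ t) x * pd i (φ t) x = gradSq (φ t) x :=
      Finset.sum_congr rfl fun i _ => (sq _).symm
    rw [hg]
    have hμx : Lam * lap (φ t) x
        = Lam / ξ ^ 2 * (φ t x ^ 3 - φ t x) - chemPot Lam ξ (φ t) x := by
      unfold chemPot
      ring
    -- Young's inequality with the weights that the Poincaré inequality turns into `Λ/2 ∫ |∇φ|²`
    -- and a multiple of `∫ |∇μ|²`
    have hyoung : 0 ≤ Lam / (6 * L ^ 2) * (φ t x - a) ^ 2
        + 3 * L ^ 2 / (2 * Lam) * (chemPot Lam ξ (φ t) x - b) ^ 2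
        - (chemPot Lam ξ (φ t) x - b) * (φ t x - a) := by
      have : Lam / (6 * L ^ 2) * (φ t x - a) ^ 2
          + 3 * L ^ 2 / (2 * Lam) * (chemPot Lam ξ (φ t) x - b) ^ 2
          - (chemPot Lam ξ (φ t) x - b) * (φ t x - a)
          = (Lam * (φ t x - a) - 3 * L ^ 2 * (chemPot Lam ξ (φ t) x - b)) ^ 2
            / (6 * L ^ 2 * Lam) := by
        field_simp
        ring
      rw [this]
      positivity
    -- `(s³ - s) (s - a)` dominates a quarter of `(s² - 1)²` up to a constant depending on `a`
    have hpot : 0 ≤ Lam / ξ ^ 2 * ((1 + a ^ 2) ^ 2 / 2 + a ^ 2 / 2 + 1 / 4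
        + (φ t x ^ 3 - φ t x) * (φ t x - a) - 1 / 4 * (φ t x ^ 2 - 1) ^ 2) := by
      refine mul_nonneg (by positivity) ?_
      nlinarith [sq_nonneg (φ t x ^ 2 - (1 + a ^ 2)), sq_nonneg (φ t x ^ 2 / 2 - a * φ t x),
        sq_nonneg (φ t x + a)]
    have hkin : 1 / 2 * normSq (u t x) ≤ ∑ i, (u t x i - m i) ^ 2 + ∑ i, m i ^ 2 := by
      rw [normSq, Finset.mul_sum, ← Finset.sum_add_distrib]
      refine Finset.sum_le_sum fun i _ => ?_
      nlinarith [sq_nonneg (u t x i - 2 * m i)]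
    have e1 : Lam * (gradSq (φ t) x + (φ t x - a) * lap (φ t) x)
        = Lam * gradSq (φ t) x + (φ t x - a)
          * (Lam / ξ ^ 2 * (φ t x ^ 3 - φ t x) - chemPot Lam ξ (φ t) x) := by
      rw [← hμx]
      ring
    rw [e1]
    have e2 : Lam / (4 * ξ ^ 2) = Lam / ξ ^ 2 * (1 / 4) := by
      rw [mul_comm 4, ← div_div]
      ring
    rw [e2, hc]
    linarith
  have hPφ := integral_sq_sub_mean_le hL hφ
  have hPμ := integral_sq_sub_mean_le hL hμ
  have hPu := fun i => integral_sq_sub_mean_le hL (hu i)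
  refine hbound.trans ?_
  rw [integral_box_add (((SmoothPeriodic.const c).add (h1.sub h2)).add h3).continuous
      (SmoothPeriodic.sum h4).continuous,
    integral_box_add ((SmoothPeriodic.const c).add (h1.sub h2)).continuous h3.continuous,
    integral_box_add continuous_const (h1.sub h2).continuous,
    integral_box_sub h1.continuous h2.continuous, integral_box_const hL.le,
    integral_const_mul, integral_const_mul, integral_const_mul,
    integral_finsetSum _ fun i _ => integrableOn_box (h4 i).continuous]
  have hDμ : 0 ≤ ∫ x in box L, gradSq (chemPot Lam ξ (φ t)) x :=
    integral_nonneg fun x => Finset.sum_nonneg fun i _ => sq_nonneg _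
  have hDu : ∀ i, 0 ≤ ∫ x in box L, gradSq (fun y => u t y i) x := fun i =>
    integral_nonneg fun x => Finset.sum_nonneg fun i _ => sq_nonneg _
  have hdiss : dissipation L ν γ Lam ξ u φ t
      = ν * (∑ i, ∫ x in box L, gradSq (fun y => u t y i) x)
        + γ * ∫ x in box L, gradSq (chemPot Lam ξ (φ t)) x := by
    unfold dissipation gradSqVec
    rw [integral_box_add
      ((SmoothPeriodic.const ν).mul (.sum fun i => (hu i).gradSq)).continuous
      ((SmoothPeriodic.const γ).mul hμ.gradSq).continuous, integral_const_mul,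
      integral_const_mul,
      integral_finsetSum _ fun i _ => integrableOn_box (hu i).gradSq.continuous]
  rw [hdiss]
  set Dφ := ∫ x in box L, gradSq (φ t) x
  set Dμ := ∫ x in box L, gradSq (chemPot Lam ξ (φ t)) x
  have hsum : ∑ i, ∫ x in box L, (u t x i - m i) ^ 2
      ≤ 3 * L ^ 2 * ∑ i, ∫ x in box L, gradSq (fun y => u t y i) x := by
    rw [Finset.mul_sum]
    exact Finset.sum_le_sum fun i _ => hPu i
  have hDu' := Finset.sum_nonneg fun i (_ : i ∈ Finset.univ) => hDu i
  set Du := ∑ i, ∫ x in box L, gradSq (fun y => u t y i) x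
  have e1 : Lam / (6 * L ^ 2) * (∫ x in box L, (φ t x - a) ^ 2) ≤ Lam / 2 * Dφ :=
    (mul_le_mul_of_nonneg_left hPφ (by positivity)).trans_eq (by field_simp; ring)
  have e2 : 3 * L ^ 2 / (2 * Lam) * (∫ x in box L, (chemPot Lam ξ (φ t) x - b) ^ 2)
      ≤ 9 * L ^ 4 / (2 * Lam * γ) * (γ * Dμ) :=
    (mul_le_mul_of_nonneg_left hPμ (by positivity)).trans_eq (by field_simp; ring)
  have e3 : 3 * L ^ 2 * Du = 3 * L ^ 2 / ν * (ν * Du) := by field_simp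
  have e4 : 0 ≤ 9 * L ^ 4 / (2 * Lam * γ) * (ν * Du) := by positivity
  have e5 : 0 ≤ 3 * L ^ 2 / ν * (γ * Dμ) := by positivity
  linarith

/-- The energy of a solution driven by a mean-zero force is bounded uniformly in time, on bounded
and unbounded time intervals alike. -/
lemma exists_energy_le (hL : 0 < L) (hν : 0 < ν) (hγ : 0 < γ) (hLam : 0 < Lam)
    (hf : ∀ i, Continuous (fun x => f x i)) (hf0 : ∀ i, ∫ x in box L, f x i = 0) :
    ∃ B, ∀ t ∈ times Tmax, energy L Lam ξ u φ t ≤ B := by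
  set κ := 9 * L ^ 4 / (2 * Lam * γ) + 3 * L ^ 2 / ν with hκ
  have hκ0 : 0 < κ := by positivity
  set C := L ^ 3 * (Lam / ξ ^ 2 * ((1 + mean L (φ 0) ^ 2) ^ 2 / 2 + mean L (φ 0) ^ 2 / 2 + 1 / 4)
          + ∑ i, mean L (fun x => u 0 x i) ^ 2) with hC
  set B := 2 * C + 2 * κ ^ 2 * l2Sq L f with hB
  refine ⟨B + |energy L Lam ξ u φ 0 - B|, fun T hT => ?_⟩
  have hle : ∀ t ∈ Ioo 0 T, -dissipation L ν γ Lam ξ u φ t + power L f u t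
      ≤ -(1 / (2 * κ)) * (energy L Lam ξ u φ t - B) := by
    intro t ht
    have htS := Ioo_subset_openTimes hT ht
    have h1 := hsol.energy_le_dissipation hL hν hγ hLam htS
    rw [hsol.mean_φ_eq hL.le (mem_times htS)] at h1
    simp_rw [hsol.mean_u_eq hL.le hf hf0 (mem_times htS)] at h1
    rw [← hκ, ← hC] at h1
    have hu := hsol.smoothPeriodic_u htS
    have hu2 : SmoothPeriodic L (fun x => 1 / (4 * κ) * normSq (u t x)) :=
      (SmoothPeriodic.const _).mul (.sum fun i => (hu i).pow 2)
    have hf2 : Continuous (fun x => κ * normSq (f x)) :=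
      continuous_const.mul (continuous_finsetSum _ fun i _ => (hf i).pow 2)
    have h2 : power L f u t ≤ 1 / (4 * κ) * l2Sq L (u t) + κ * l2Sq L f := by
      unfold power l2Sq
      rw [← integral_const_mul, ← integral_const_mul, ← integral_box_add hu2.continuous hf2]
      refine integral_box_mono
        (continuous_finsetSum _ fun i _ => (hu i).continuous.mul (hf i))
        (hu2.continuous.add hf2) fun x => ?_
      simp only [normSq, Finset.mul_sum, ← Finset.sum_add_distrib]
      refine Finset.sum_le_sum fun i _ => ?_
      have : 1 / (4 * κ) * u t x i ^ 2 + κ * f x i ^ 2 - u t x i * f x i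
          = (u t x i - 2 * κ * f x i) ^ 2 / (4 * κ) := by
        field_simp
        ring
      have h0 : 0 ≤ (u t x i - 2 * κ * f x i) ^ 2 / (4 * κ) := by positivity
      linarith
    have h3 := hsol.l2Sq_le_energy hLam.le (mem_times htS)
    have h4 : 1 / (4 * κ) * l2Sq L (u t) ≤ 1 / (2 * κ) * energy L Lam ξ u φ t :=
      (mul_le_mul_of_nonneg_left h3 (by positivity)).trans_eq (by field_simp; ring)
    have h5 : 1 / κ * energy L Lam ξ u φ t ≤ dissipation L ν γ Lam ξ u φ t + 1 / κ * C :=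
      (mul_le_mul_of_nonneg_left h1 (by positivity)).trans_eq (by field_simp)
    have h6 : -(1 / (2 * κ)) * (energy L Lam ξ u φ t - B)
        = -(1 / κ * energy L Lam ξ u φ t) + 1 / (2 * κ) * energy L Lam ξ u φ t
          + 1 / κ * C + κ * l2Sq L f := by
      rw [hB]
      field_simp
      ring
    linarith
  have h := sub_le_exp_mul_of_deriv_le hT.1 (hsol.continuousOn_energy hT)
    (fun t ht => hsol.hasDerivAt_energy hL.le hf (Ioo_subset_openTimes hT ht)) hle
  have hexp : Real.exp (-(1 / (2 * κ)) * T) ≤ 1 := by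
    rw [Real.exp_le_one_iff]
    have : 0 ≤ 1 / (2 * κ) * T := mul_nonneg (by positivity) hT.1
    linarith
  have h7 : Real.exp (-(1 / (2 * κ)) * T) * (energy L Lam ξ u φ 0 - B)
      ≤ |energy L Lam ξ u φ 0 - B| :=
    (mul_le_mul_of_nonneg_left (le_abs_self _) (Real.exp_pos _).le).trans
      (mul_le_of_le_one_left (abs_nonneg _) hexp)
  linarith

end IsSolution

/-! ### Time averages -/

/-- Jensen's inequality for the square root, from `⟨(√h - ⟨√h⟩)²⟩ ≥ 0`. -/
lemma timeAvg_sqrt_le {T : ℝ} (hT : 0 < T) {h : ℝ → ℝ} (hh : ContinuousOn h (Icc 0 T))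
    (h0 : ∀ t, 0 ≤ h t) : timeAvg T (fun t => √(h t)) ≤ √(timeAvg T h) := by
  rw [← uIcc_of_le hT.le] at hh
  have hi := hh.intervalIntegrable (μ := volume)
  have hi' := hh.sqrt.intervalIntegrable (μ := volume)
  refine Real.le_sqrt_of_sq_le ?_
  set a := timeAvg T (fun t => √(h t)) with ha
  have hsq : 0 ≤ ∫ t in (0 : ℝ)..T, (√(h t) - a) ^ 2 :=
    intervalIntegral.integral_nonneg hT.le fun t _ => sq_nonneg _
  have e : ∀ t, (√(h t) - a) ^ 2 = h t - 2 * a * √(h t) + a ^ 2 := fun t => by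
    rw [sub_sq, Real.sq_sqrt (h0 t)]
    ring
  simp_rw [e] at hsq
  rw [intervalIntegral.integral_add (hi.sub (hi'.const_mul _)) intervalIntegrable_const,
    intervalIntegral.integral_sub hi (hi'.const_mul _), intervalIntegral.integral_const_mul,
    intervalIntegral.integral_const] at hsq
  have e2 : ∫ t in (0 : ℝ)..T, √(h t) = T * a := by
    rw [ha, timeAvg]
    field_simp
  rw [e2, sub_zero, smul_eq_mul] at hsq
  rw [timeAvg, one_div, ← div_eq_inv_mul, le_div_iff₀ hT]
  linarith

lemma timeAvg_mono {T : ℝ} (hT : 0 ≤ T) {g h : ℝ → ℝ} (hg : ContinuousOn g (Icc 0 T))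
    (hh : ContinuousOn h (Icc 0 T)) (hgh : ∀ t ∈ Icc 0 T, g t ≤ h t) :
    timeAvg T g ≤ timeAvg T h := by
  have hg' := hg
  have hh' := hh
  rw [← uIcc_of_le hT] at hg' hh'
  exact mul_le_mul_of_nonneg_left (intervalIntegral.integral_mono_on hT hg'.intervalIntegrable
    hh'.intervalIntegrable hgh) (by positivity)

lemma timeAvg_const_mul (T c : ℝ) (g : ℝ → ℝ) :
    timeAvg T (fun t => c * g t) = c * timeAvg T g := by
  simp only [timeAvg, intervalIntegral.integral_const_mul]
  ring

lemma timeAvg_nonneg {T : ℝ} (hT : 0 ≤ T) {g : ℝ → ℝ} (hg : ∀ t, 0 ≤ g t) : 0 ≤ timeAvg T g :=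
  mul_nonneg (by positivity) (intervalIntegral.integral_nonneg hT fun t _ => hg t)

lemma normSq_nonneg (v : Space) : 0 ≤ normSq v := Finset.sum_nonneg fun _ _ => sq_nonneg _

lemma l2Sq_nonneg (L : ℝ) (v : Space → Space) : 0 ≤ l2Sq L v :=
  integral_nonneg fun _ => normSq_nonneg _

/-- The Cauchy-Schwarz inequality for vector fields on the cell. -/
lemma abs_integral_dot_le {L : ℝ} {v w : Space → Space} (hv : ∀ i, Continuous (fun x => v x i))
    (hw : ∀ i, Continuous (fun x => w x i)) :
    |∫ x in box L, ∑ i, v x i * w x i| ≤ √(l2Sq L v) * √(l2Sq L w) := by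
  have hv2 : Continuous (fun x => normSq (v x)) := continuous_finsetSum _ fun i _ => (hv i).pow 2
  have hw2 : Continuous (fun x => normSq (w x)) := continuous_finsetSum _ fun i _ => (hw i).pow 2
  have hvw : Continuous (fun x => ∑ i, v x i * w x i) :=
    continuous_finsetSum _ fun i _ => (hv i).mul (hw i)
  -- `∫ |r w + v|² ≥ 0` for all `r`
  have hquad : ∀ r : ℝ, 0 ≤ l2Sq L w * (r * r) + 2 * (∫ x in box L, ∑ i, v x i * w x i) * r
      + l2Sq L v := by
    intro r
    have h0 : 0 ≤ ∫ x in box L, (r * r * normSq (w x) + 2 * r * (∑ i, v x i * w x i)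
        + normSq (v x)) := by
      refine integral_nonneg fun x => ?_
      have : r * r * normSq (w x) + 2 * r * (∑ i, v x i * w x i) + normSq (v x)
          = ∑ i, (r * w x i + v x i) ^ 2 := by
        simp only [normSq, Fin.sum_univ_three]
        ring
      change 0 ≤ r * r * normSq (w x) + 2 * r * (∑ i, v x i * w x i) + normSq (v x)
      rw [this]
      exact Finset.sum_nonneg fun i _ => sq_nonneg _
    have a1 : Continuous (fun x => r * r * normSq (w x)) := continuous_const.mul hw2
    have a2 : Continuous (fun x => 2 * r * ∑ i, v x i * w x i) := continuous_const.mul hvw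
    have a3 : Continuous (fun x => r * r * normSq (w x) + 2 * r * ∑ i, v x i * w x i) := a1.add a2
    rw [integral_box_add a3 hv2, integral_box_add a1 a2,
      integral_const_mul, integral_const_mul] at h0
    unfold l2Sq
    linarith
  have hdisc := discrim_le_zero hquad
  rw [← Real.sqrt_mul (l2Sq_nonneg L v)]
  refine Real.abs_le_sqrt ?_
  unfold discrim at hdisc
  linarith

namespace IsSolution

variable {L ν γ Lam ξ : ℝ} {f : Space → Space} {Tmax : EReal} {u : ℝ → Space → Space}
  {φ p : ℝ → Space → ℝ} {t T : ℝ} (hsol : IsSolution L ν γ Lam ξ f Tmax u φ p)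

lemma dissipation_nonneg (hν : 0 ≤ ν) (hγ : 0 ≤ γ) : 0 ≤ dissipation L ν γ Lam ξ u φ t :=
  integral_nonneg fun _ => add_nonneg
    (mul_nonneg hν (Finset.sum_nonneg fun _ _ => Finset.sum_nonneg fun _ _ => sq_nonneg _))
    (mul_nonneg hγ (Finset.sum_nonneg fun _ _ => sq_nonneg _))

include hsol

lemma continuousOn_l2Sq (hT : T ∈ times Tmax) :
    ContinuousOn (fun t => l2Sq L (u t)) (Icc 0 T) :=
  continuousOn_integral (G := fun t x => normSq (u t x)) hsol.continuousOn_normSq hT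

lemma continuousOn_power (hf : ∀ i, Continuous (fun x => f x i)) (hT : T ∈ times Tmax) :
    ContinuousOn (power L f u) (Icc 0 T) :=
  continuousOn_integral (G := fun t x => ∑ i, u t x i * f x i) (hsol.continuousOn_dot hf) hT

lemma continuous_slice_u (ht : t ∈ times Tmax) (i : Fin 3) : Continuous (fun x => u t x i) :=
  continuous_slice (G := fun t x => u t x i) (hsol.continuousOn_u i) ht

/-- The dissipation is integrable up to `t = 0`: it is bounded below, and up to bounded terms it is
the derivative of a function continuous down to `t = 0`. -/
lemma intervalIntegrable_dissipation (hL : 0 ≤ L) (hν : 0 ≤ ν) (hγ : 0 ≤ γ)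
    (hf : ∀ i, Continuous (fun x => f x i)) (hT : T ∈ times Tmax) :
    IntervalIntegrable (dissipation L ν γ Lam ξ u φ) volume 0 T := by
  have hP := hsol.continuousOn_power hf hT
  obtain ⟨M, hM⟩ := isCompact_Icc.exists_bound_of_continuousOn hP
  -- the derivative of `M t - E` is `D - P + M ≥ 0`
  have hcont : ContinuousOn (fun t => M * t - energy L Lam ξ u φ t) (Icc 0 T) :=
    (continuousOn_const.mul continuousOn_id).sub (hsol.continuousOn_energy hT)
  have hint := intervalIntegral.integrableOn_deriv_of_nonneg hcont
    (g' := fun t => M * 1 - (-dissipation L ν γ Lam ξ u φ t + power L f u t))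
    (fun t ht => ((hasDerivAt_id t).const_mul M).sub
      (hsol.hasDerivAt_energy hL hf (Ioo_subset_openTimes hT ht)))
    (fun t ht => by
      have h1 := hM t (Ioo_subset_Icc_self ht)
      have h2 := (abs_le.1 h1).2
      have h3 := dissipation_nonneg (L := L) (Lam := Lam) (ξ := ξ) (u := u) (φ := φ) (t := t) hν hγ
      linarith)
  rw [← intervalIntegrable_iff_integrableOn_Ioc_of_le hT.1] at hint
  have hP' : IntervalIntegrable (power L f u) volume 0 T := by
    rw [← uIcc_of_le hT.1] at hP
    exact hP.intervalIntegrable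
  convert (hint.add hP').sub (intervalIntegrable_const (c := M)) using 1
  funext t
  simp only [mul_one]
  ring

/-- The time-averaged energy inequality. -/
lemma timeAvg_dissipation_le (hL : 0 ≤ L) (hν : 0 ≤ ν) (hγ : 0 ≤ γ) (hLam : 0 ≤ Lam)
    (hf : ∀ i, Continuous (fun x => f x i)) (hT0 : 0 < T) (hT : T ∈ times Tmax) :
    timeAvg T (dissipation L ν γ Lam ξ u φ)
      ≤ √(l2Sq L f) * √(timeAvg T (fun t => l2Sq L (u t))) + energy L Lam ξ u φ 0 / T := by
  have hD := hsol.intervalIntegrable_dissipation hL hν hγ hf hT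
  have hPc := hsol.continuousOn_power hf hT
  have hP : IntervalIntegrable (power L f u) volume 0 T := by
    have := hPc
    rw [← uIcc_of_le hT.1] at this
    exact this.intervalIntegrable
  have hDn : IntervalIntegrable (fun t => -dissipation L ν γ Lam ξ u φ t) volume 0 T := hD.neg
  have hFTC := intervalIntegral.integral_eq_sub_of_hasDerivAt_of_le hT.1
    (hsol.continuousOn_energy hT)
    (fun t ht => hsol.hasDerivAt_energy hL hf (Ioo_subset_openTimes hT ht)) (hDn.add hP)
  rw [intervalIntegral.integral_add hDn hP, intervalIntegral.integral_neg] at hFTC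
  have hE := energy_nonneg (L := L) (ξ := ξ) (u := u) (φ := φ) (t := T) hLam
  have h1 : timeAvg T (dissipation L ν γ Lam ξ u φ)
      ≤ timeAvg T (power L f u) + energy L Lam ξ u φ 0 / T := by
    unfold timeAvg
    rw [div_eq_mul_one_div (energy L Lam ξ u φ 0), mul_comm (energy L Lam ξ u φ 0), ← mul_add]
    exact mul_le_mul_of_nonneg_left (by linarith) (by positivity)
  have h2 : timeAvg T (power L f u) ≤ timeAvg T (fun t => √(l2Sq L f) * √(l2Sq L (u t))) :=
    timeAvg_mono hT.1 hPc (continuousOn_const.mul (hsol.continuousOn_l2Sq hT).sqrt)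
      fun t ht => (le_abs_self _).trans ((abs_integral_dot_le
        (hsol.continuous_slice_u (Icc_subset_times hT ht)) hf).trans_eq (mul_comm _ _))
  rw [timeAvg_const_mul] at h2
  have h3 := mul_le_mul_of_nonneg_left
    (timeAvg_sqrt_le hT0 (hsol.continuousOn_l2Sq hT) fun t => l2Sq_nonneg L (u t))
    (Real.sqrt_nonneg (l2Sq L f))
  linarith

/-- The time-averaged momentum balance tested with the force. The boundary terms are bounded
uniformly in time by the energy bound. -/
lemma exists_l2Sq_force_le (hL : 0 < L) (hν : 0 < ν) (hγ : 0 < γ) (hLam : 0 < Lam)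
    (hf : ∀ i, SmoothPeriodic L (fun x => f x i)) (hfdiv : ∀ x, divergence f x = 0)
    (hf0 : ∀ i, ∫ x in box L, f x i = 0) {M : ℝ}
    (hM : ∀ x ∈ box L, ∀ i j, |pd j (fun y => f y i) x| ≤ M) :
    ∃ C, ∀ T : ℝ, 0 < T → (T : EReal) < Tmax →
      l2Sq L f ≤ 3 * M * timeAvg T (fun t => l2Sq L (u t))
        + ν * √(l2Sq L fun x i => lap (fun y => f y i) x)
          * √(timeAvg T (fun t => l2Sq L (u t)))
        + 3 * M * (Lam * timeAvg T (fun t => ∫ x in box L, gradSq (φ t) x)) + C / T := by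
  have hfc : ∀ i, Continuous (fun x => f x i) := fun i => (hf i).continuous
  have hlc : ∀ i, Continuous (fun x => lap (fun y => f y i) x) := fun i => (hf i).lap.continuous
  set N := √(l2Sq L fun x i => lap (fun y => f y i) x) with hN
  obtain ⟨B, hB⟩ := hsol.exists_energy_le hL hν hγ hLam hfc hf0
  have hpow : ∀ t ∈ times Tmax, |power L f u t| ≤ √(2 * B) * √(l2Sq L f) := fun t ht =>
    (abs_integral_dot_le (hsol.continuous_slice_u ht) hfc).trans <|
      mul_le_mul_of_nonneg_right (Real.sqrt_le_sqrt <|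
        (hsol.l2Sq_le_energy hLam.le ht).trans (by linarith [hB t ht])) (Real.sqrt_nonneg _)
  refine ⟨2 * (√(2 * B) * √(l2Sq L f)), fun T hT0 hTm => ?_⟩
  have hT : T ∈ times Tmax := ⟨hT0.le, hTm⟩
  have huc := hsol.continuousOn_l2Sq hT
  have hgc : ContinuousOn (fun t => ∫ x in box L, gradSq (φ t) x) (Icc 0 T) :=
    continuousOn_integral (G := fun t x => gradSq (φ t) x) hsol.continuousOn_gradSq hT
  have hlow : ∀ t ∈ Ioo 0 T,
      l2Sq L f - 3 * M * l2Sq L (u t) - ν * N * √(l2Sq L (u t))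
        - 3 * M * Lam * (∫ x in box L, gradSq (φ t) x)
      ≤ ∫ x in box L, ((∑ i, ∑ j, u t x i * u t x j * pd j (fun y => f y i) x)
        + ν * (∑ i, u t x i * lap (fun y => f y i) x)
        + Lam * (∑ i, ∑ j, pd i (φ t) x * pd j (φ t) x * pd j (fun y => f y i) x)
        + ∑ i, f x i * f x i) := by
    intro t ht
    have htS := Ioo_subset_openTimes hT ht
    have hu := hsol.smoothPeriodic_u htS
    have hφ := hsol.smoothPeriodic_φ htS
    -- `|Σ vᵢ vⱼ ∂ⱼfᵢ| ≤ M (Σ |vᵢ|)² ≤ 3 M |v|²`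
    have hquad : ∀ x ∈ box L, ∀ v : Space,
        -(3 * M * ∑ i, v i ^ 2) ≤ ∑ i, ∑ j, v i * v j * pd j (fun y => f y i) x := by
      intro x hx v
      have hM0 : 0 ≤ M := (abs_nonneg _).trans (hM x hx 0 0)
      have h1 : ∀ i j, -(M * (|v i| * |v j|)) ≤ v i * v j * pd j (fun y => f y i) x := by
        intro i j
        have : |v i * v j * pd j (fun y => f y i) x| ≤ |v i| * |v j| * M := by
          rw [abs_mul, abs_mul]
          exact mul_le_mul_of_nonneg_left (hM x hx i j) (by positivity)
        linarith [(abs_le.1 this).1]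
      have h2 : ∑ i, ∑ j, -(M * (|v i| * |v j|))
          ≤ ∑ i, ∑ j, v i * v j * pd j (fun y => f y i) x :=
        Finset.sum_le_sum fun i _ => Finset.sum_le_sum fun j _ => h1 i j
      refine le_trans ?_ h2
      have h3 : (∑ i, |v i|) ^ 2 ≤ 3 * ∑ i, v i ^ 2 := by
        have := sq_sum_le_card_mul_sum_sq (s := Finset.univ) (f := fun i => |v i|)
        simpa using this
      have h4 : ∑ i, ∑ j, -(M * (|v i| * |v j|)) = -(M * (∑ i, |v i|) ^ 2) := by
        simp only [Fin.sum_univ_three]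
        ring
      rw [h4]
      nlinarith
    have c1 : SmoothPeriodic L
        (fun x => ∑ i, ∑ j, u t x i * u t x j * pd j (fun y => f y i) x) :=
      .sum fun i => .sum fun j => ((hu i).mul (hu j)).mul ((hf i).pd j)
    have c2 : SmoothPeriodic L (fun x => ∑ i, u t x i * lap (fun y => f y i) x) :=
      .sum fun i => (hu i).mul (hf i).lap
    have c3 : SmoothPeriodic L
        (fun x => ∑ i, ∑ j, pd i (φ t) x * pd j (φ t) x * pd j (fun y => f y i) x) :=
      .sum fun i => .sum fun j => ((hφ.pd i).mul (hφ.pd j)).mul ((hf i).pd j)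
    have c4 : SmoothPeriodic L (fun x => ∑ i, f x i * f x i) := .sum fun i => (hf i).mul (hf i)
    have k1 : SmoothPeriodic L (fun x => normSq (u t x)) := .sum fun i => (hu i).pow 2
    rw [integral_box_add ((c1.add ((SmoothPeriodic.const ν).mul c2)).add
        ((SmoothPeriodic.const Lam).mul c3)).continuous c4.continuous,
      integral_box_add (c1.add ((SmoothPeriodic.const ν).mul c2)).continuous
        ((SmoothPeriodic.const Lam).mul c3).continuous,
      integral_box_add c1.continuous ((SmoothPeriodic.const ν).mul c2).continuous,
      integral_const_mul, integral_const_mul]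
    have i1 : -(3 * M * l2Sq L (u t))
        ≤ ∫ x in box L, ∑ i, ∑ j, u t x i * u t x j * pd j (fun y => f y i) x := by
      unfold l2Sq
      rw [← integral_const_mul, ← integral_neg]
      exact setIntegral_mono_on (integrableOn_box (continuous_const.mul k1.continuous).neg)
        (integrableOn_box c1.continuous) (measurableSet_box L) fun x hx => hquad x hx (u t x)
    have i2 : -(N * √(l2Sq L (u t))) ≤ ∫ x in box L, ∑ i, u t x i * lap (fun y => f y i) x := by
      have := abs_integral_dot_le (L := L) (v := u t) (w := fun x i => lap (fun y => f y i) x)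
        (fun i => (hu i).continuous) hlc
      linarith [(abs_le.1 this).1]
    have i3 : -(3 * M * ∫ x in box L, gradSq (φ t) x) ≤ ∫ x in box L,
        ∑ i, ∑ j, pd i (φ t) x * pd j (φ t) x * pd j (fun y => f y i) x := by
      rw [← integral_const_mul, ← integral_neg]
      exact setIntegral_mono_on
        (integrableOn_box (continuous_const.mul hφ.gradSq.continuous).neg)
        (integrableOn_box c3.continuous) (measurableSet_box L)
        fun x hx => hquad x hx fun i => pd i (φ t) x
    have i4 : ∫ x in box L, ∑ i, f x i * f x i = l2Sq L f := by
      simp only [l2Sq, normSq, sq]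
    have i2' := mul_le_mul_of_nonneg_left i2 hν.le
    have i3' := mul_le_mul_of_nonneg_left i3 hLam.le
    rw [i4]
    linarith
  have hlowc : ContinuousOn (fun t => l2Sq L f - 3 * M * l2Sq L (u t)
      - ν * N * √(l2Sq L (u t)) - 3 * M * Lam * (∫ x in box L, gradSq (φ t) x)) (Icc 0 T) :=
    ((continuousOn_const.sub (continuousOn_const.mul huc)).sub
      (continuousOn_const.mul huc.sqrt)).sub (continuousOn_const.mul hgc)
  have hFTC := intervalIntegral.integral_le_sub_of_hasDeriv_right_of_le hT0.le
    (hsol.continuousOn_power hfc hT)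
    (fun t ht => (hsol.hasDerivAt_integral_dot hL.le hfc hf hfdiv
      (Ioo_subset_openTimes hT ht)).hasDerivWithinAt)
    (hlowc.integrableOn_compact isCompact_Icc) hlow
  have hu' := huc
  have hg' := hgc
  rw [← uIcc_of_le hT0.le] at hu' hg'
  have iu := hu'.intervalIntegrable (μ := volume)
  have ius := hu'.sqrt.intervalIntegrable (μ := volume)
  have ig := hg'.intervalIntegrable (μ := volume)
  rw [intervalIntegral.integral_sub ((intervalIntegrable_const.sub (iu.const_mul _)).sub
      (ius.const_mul _)) (ig.const_mul _),
    intervalIntegral.integral_sub (intervalIntegrable_const.sub (iu.const_mul _))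
      (ius.const_mul _),
    intervalIntegral.integral_sub intervalIntegrable_const (iu.const_mul _),
    intervalIntegral.integral_const_mul, intervalIntegral.integral_const_mul,
    intervalIntegral.integral_const_mul, intervalIntegral.integral_const, sub_zero,
    smul_eq_mul] at hFTC
  have hbd : power L f u T - power L f u 0 ≤ 2 * (√(2 * B) * √(l2Sq L f)) := by
    have h1 := (abs_le.1 (hpow T hT)).2
    have h2 := (abs_le.1 (hpow 0 (Icc_subset_times hT (left_mem_Icc.2 hT0.le)))).1
    linarith
  have hs := mul_le_mul_of_nonneg_left
    (timeAvg_sqrt_le hT0 huc fun t => l2Sq_nonneg L (u t)) (mul_nonneg hν.le (Real.sqrt_nonneg _) :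
      0 ≤ ν * N)
  have hmain : l2Sq L f ≤ 3 * M * timeAvg T (fun t => l2Sq L (u t))
      + ν * N * timeAvg T (fun t => √(l2Sq L (u t)))
      + 3 * M * (Lam * timeAvg T (fun t => ∫ x in box L, gradSq (φ t) x))
      + 2 * (√(2 * B) * √(l2Sq L f)) / T := by
    refine le_of_mul_le_mul_left ?_ hT0
    have : T * (3 * M * timeAvg T (fun t => l2Sq L (u t))
      + ν * N * timeAvg T (fun t => √(l2Sq L (u t)))
      + 3 * M * (Lam * timeAvg T (fun t => ∫ x in box L, gradSq (φ t) x))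
      + 2 * (√(2 * B) * √(l2Sq L f)) / T)
      = 3 * M * (∫ t in (0 : ℝ)..T, l2Sq L (u t))
      + ν * N * (∫ t in (0 : ℝ)..T, √(l2Sq L (u t)))
      + 3 * M * Lam * (∫ t in (0 : ℝ)..T, ∫ x in box L, gradSq (φ t) x)
      + 2 * (√(2 * B) * √(l2Sq L f)) := by
      unfold timeAvg
      field_simp
    rw [this]
    linarith
  linarith

/-- The `γ`-independent bound on the time average of `∫ |∇φ|²`. -/
lemma timeAvg_gradSq_le (hL : 0 ≤ L) (hγ : 0 < γ) (hLam : 0 < Lam) (hξ : 0 < ξ) (hT0 : 0 < T)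
    (hT : T ∈ times Tmax) :
    timeAvg T (fun t => ∫ x in box L, gradSq (φ t) x)
      ≤ 3 * L ^ 3 / ξ ^ 2 + ξ ^ 2 / (2 * γ * Lam) * (∫ x in box L, φ 0 x ^ 2) / T := by
  have hgc : ContinuousOn (fun t => ∫ x in box L, gradSq (φ t) x) (Icc 0 T) :=
    continuousOn_integral (G := fun t x => gradSq (φ t) x) hsol.continuousOn_gradSq hT
  have hφc : ContinuousOn (fun t => ∫ x in box L, φ t x ^ 2) (Icc 0 T) :=
    continuousOn_integral (G := fun t x => φ t x ^ 2) (hsol.continuous_φ.pow 2) hT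
  have hFTC := intervalIntegral.integral_le_sub_of_hasDeriv_right_of_le hT0.le
    (g := fun t => 3 * L ^ 3 / ξ ^ 2 * t - ξ ^ 2 / (2 * γ * Lam) * ∫ x in box L, φ t x ^ 2)
    ((continuousOn_const.mul continuousOn_id).sub (continuousOn_const.mul hφc))
    (fun t ht => (((hasDerivAt_id t).const_mul _).sub
      ((hsol.hasDerivAt_integral_sq_φ (Ioo_subset_openTimes hT ht)).const_mul
        _)).hasDerivWithinAt)
    (hgc.integrableOn_compact isCompact_Icc) fun t ht => by
      rw [mul_one]
      exact hsol.integral_gradSq_φ_le hL hγ hLam hξ (Ioo_subset_openTimes hT ht)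
  have h0 : 0 ≤ ξ ^ 2 / (2 * γ * Lam) * ∫ x in box L, φ T x ^ 2 :=
    mul_nonneg (by positivity) (integral_nonneg fun x => sq_nonneg _)
  simp only [mul_zero, zero_sub] at hFTC
  refine le_of_mul_le_mul_left ?_ hT0
  have e1 : T * timeAvg T (fun t => ∫ x in box L, gradSq (φ t) x)
      = ∫ t in (0 : ℝ)..T, ∫ x in box L, gradSq (φ t) x := by
    unfold timeAvg
    field_simp
  have e2 : T * (3 * L ^ 3 / ξ ^ 2 + ξ ^ 2 / (2 * γ * Lam) * (∫ x in box L, φ 0 x ^ 2) / T)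
      = 3 * L ^ 3 / ξ ^ 2 * T + ξ ^ 2 / (2 * γ * Lam) * ∫ x in box L, φ 0 x ^ 2 := by
    field_simp
  rw [e1, e2]
  linarith

end IsSolution

/-! ### Scaling of the force -/

section Scaling

variable {L : ℝ} {g : Space → ℝ}

lemma SmoothPeriodic.dilate (hL : L ≠ 0) (hg : SmoothPeriodic 1 g) :
    SmoothPeriodic L (fun x => g (L⁻¹ • x)) :=
  ⟨hg.smooth.comp (contDiff_const_smul _), fun i x => by
    have : L⁻¹ • (Pi.single i L : Space) = Pi.single i 1 := by
      rw [← Pi.single_smul, smul_eq_mul, inv_mul_cancel₀ hL]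
    rw [smul_add, this, hg.periodic i]⟩

lemma pd_dilate (r : ℝ) {x : Space} (hg : DifferentiableAt ℝ g (r • x)) (i : Fin 3) :
    pd i (fun y => g (r • y)) x = r * pd i g (r • x) := by
  have h1 : HasFDerivAt (fun y : Space => r • y) (r • ContinuousLinearMap.id ℝ Space) x :=
    (hasFDerivAt_id x).const_smul r
  have h2 := (hg.hasFDerivAt.comp x h1).fderiv
  unfold pd
  rw [show (fun y => g (r • y)) = g ∘ fun y => r • y from rfl, h2]
  simp

open scoped Pointwise in
lemma integral_dilate (hL : 0 < L) (g : Space → ℝ) :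
    ∫ x in box L, g (L⁻¹ • x) = L ^ 3 * ∫ x in box 1, g x := by
  have hbox : L⁻¹ • box L = box 1 := by
    ext x
    rw [mem_inv_smul_set_iff₀ hL.ne']
    simp only [box, mem_Icc, Pi.le_def, Pi.smul_apply, smul_eq_mul, Pi.zero_apply]
    refine and_congr (forall_congr' fun i => ?_) (forall_congr' fun i => ?_)
    · exact mul_nonneg_iff_of_pos_left hL
    · exact mul_le_iff_le_one_right hL
  rw [Measure.setIntegral_comp_smul_of_pos _ _ _ (inv_pos.2 hL), hbox]
  simp

lemma l2Sq_dilate (hL : 0 < L) (c : ℝ) (W : Space → Space) :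
    l2Sq L (fun x => c • W (L⁻¹ • x)) = c ^ 2 * L ^ 3 * l2Sq 1 W := by
  have : ∀ x, normSq (c • W (L⁻¹ • x)) = c ^ 2 * normSq (W (L⁻¹ • x)) := fun x => by
    simp only [normSq, Pi.smul_apply, smul_eq_mul, mul_pow, Finset.mul_sum]
  simp only [l2Sq, this]
  rw [integral_const_mul, integral_dilate hL (fun x => normSq (W x)), mul_assoc]

variable {Φ : Space → Space} {F : ℝ}

lemma IsShape.smoothPeriodic (hΦ : IsShape Φ) (i : Fin 3) : SmoothPeriodic 1 (fun x => Φ x i) :=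
  ⟨contDiff_pi.1 hΦ.smooth i, fun j x => by simp only [hΦ.periodic j x]⟩

lemma IsShape.smoothPeriodic_force (hΦ : IsShape Φ) (hL : L ≠ 0) (i : Fin 3) :
    SmoothPeriodic L (fun x => force F L Φ x i) :=
  (SmoothPeriodic.const F).mul ((hΦ.smoothPeriodic i).dilate hL)

lemma IsShape.pd_force (hΦ : IsShape Φ) (hL : L ≠ 0) (i j : Fin 3) (x : Space) :
    pd j (fun y => force F L Φ y i) x = F * L⁻¹ * pd j (fun y => Φ y i) (L⁻¹ • x) := by
  have h := hΦ.smoothPeriodic i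
  change pd j (fun y => F * (fun z => Φ z i) (L⁻¹ • y)) x = _
  rw [pd_const_mul _ (h.dilate hL).differentiableAt, pd_dilate _ h.differentiableAt, mul_assoc]

lemma IsShape.lap_force (hΦ : IsShape Φ) (hL : L ≠ 0) (i : Fin 3) (x : Space) :
    lap (fun y => force F L Φ y i) x = F * L⁻¹ ^ 2 * lap (fun y => Φ y i) (L⁻¹ • x) := by
  have h := hΦ.smoothPeriodic i
  unfold lap
  rw [Finset.mul_sum]
  refine Finset.sum_congr rfl fun j _ => ?_
  have : pd j (fun y => force F L Φ y i)
      = fun x => F * L⁻¹ * pd j (fun y => Φ y i) (L⁻¹ • x) :=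
    funext fun x => hΦ.pd_force hL i j x
  rw [this, pd_const_mul _ ((h.pd j).dilate hL).differentiableAt,
    pd_dilate _ (h.pd j).differentiableAt]
  ring

lemma IsShape.divergence_force (hΦ : IsShape Φ) (hL : L ≠ 0) (x : Space) :
    divergence (force F L Φ) x = 0 := by
  have := hΦ.div_free (L⁻¹ • x)
  unfold divergence at this ⊢
  simp only [hΦ.pd_force hL, ← Finset.mul_sum, this, mul_zero]

lemma IsShape.integral_force (hΦ : IsShape Φ) (hL : 0 < L) (i : Fin 3) :
    ∫ x in box L, force F L Φ x i = 0 := by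
  change ∫ x in box L, F * (fun y => Φ y i) (L⁻¹ • x) = 0
  rw [integral_const_mul, integral_dilate hL fun y => Φ y i, hΦ.mean_zero, mul_zero, mul_zero]

lemma sqrt_l2Sq_dilate (hL : 0 < L) {c : ℝ} (hc : 0 ≤ c) (W : Space → Space) :
    √(l2Sq L (fun x => c • W (L⁻¹ • x))) = c * √(L ^ 3) * √(l2Sq 1 W) := by
  rw [l2Sq_dilate hL, Real.sqrt_mul (by positivity), Real.sqrt_mul (by positivity),
    Real.sqrt_sq hc]

lemma rpow_three_halves (hL : 0 ≤ L) : L ^ (3 / 2 : ℝ) = √(L ^ 3) := by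
  rw [Real.sqrt_eq_rpow, ← Real.rpow_natCast, ← Real.rpow_mul hL]
  norm_num

lemma sqrt_timeAvg_eq (hL : 0 < L) (u : ℝ → Space → Space) (T : ℝ) :
    √(timeAvg T fun t => l2Sq L (u t)) = √(L ^ 3) * avgVelocity L u T := by
  rw [avgVelocity, ← Real.sqrt_mul (by positivity), mul_inv_cancel_left₀ (by positivity)]

end Scaling

/-! ### The Grashof and Reynolds numbers -/

lemma reynolds_nonneg {L ν : ℝ} (hL : 0 ≤ L) (hν : 0 ≤ ν) (u : ℝ → Space → Space) (T : ℝ) :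
    0 ≤ reynolds L ν u T :=
  div_nonneg (mul_nonneg (Real.sqrt_nonneg _) hL) hν

/-- The bound of `Gr` by `Re` and the mean capillary energy. The constants depend on the shape
through `sup |∇Φ| / ‖Φ‖₂` and `‖ΔΦ‖₂ / ‖Φ‖₂`. -/
lemma exists_grashof_le {Φ : Space → Space} (hΦ : IsShape Φ) :
    ∃ A B : ℝ, 0 ≤ A ∧ 0 ≤ B ∧ ∀ (L ν γ Lam ξ F : ℝ), 0 < L → 0 < ν → 0 < γ → 0 < Lam → 0 ≤ F →
      ∀ (Tmax : EReal) (u : ℝ → Space → Space) (φ p : ℝ → Space → ℝ),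
      IsSolution L ν γ Lam ξ (force F L Φ) Tmax u φ p →
        ∃ C, ∀ T : ℝ, 0 < T → (T : EReal) < Tmax →
          grashof L ν (force F L Φ) ≤ A * reynolds L ν u T ^ 2 + B * reynolds L ν u T
            + A * (Lam * timeAvg T (fun t => ∫ x in box L, gradSq (φ t) x) / (L * ν ^ 2))
            + C / T := by
  have hK : ∃ K, 0 ≤ K ∧ ∀ x ∈ box 1, ∀ i j, |pd j (fun y => Φ y i) x| ≤ K := by
    have hc : Continuous (fun x => fun q : Fin 3 × Fin 3 => pd q.2 (fun y => Φ y q.1) x) :=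
      continuous_pi fun q => ((hΦ.smoothPeriodic q.1).pd q.2).continuous
    obtain ⟨K, hK⟩ := (isCompact_box 1).exists_bound_of_continuousOn hc.continuousOn
    refine ⟨max K 0, le_max_right _ _, fun x hx i j => ?_⟩
    exact (norm_le_pi_norm (fun q : Fin 3 × Fin 3 => pd q.2 (fun y => Φ y q.1) x)
      (i, j)).trans ((hK x hx).trans (le_max_left _ _))
  obtain ⟨K, hK0, hK⟩ := hK
  set a := √(l2Sq 1 Φ) with ha
  set b := √(l2Sq 1 fun x i => lap (fun y => Φ y i) x) with hb
  have ha0 : 0 ≤ a := Real.sqrt_nonneg _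
  have hb0 : 0 ≤ b := Real.sqrt_nonneg _
  refine ⟨3 * K / a, b / a, by positivity, by positivity, ?_⟩
  intro L ν γ Lam ξ F hL hν hγ hLam hF Tmax u φ p hsol
  set s := √(L ^ 3) with hs
  have hs2 : s ^ 2 = L ^ 3 := Real.sq_sqrt (by positivity)
  have hnorm : √(l2Sq L (force F L Φ)) = F * s * a := sqrt_l2Sq_dilate hL hF Φ
  have hGr : grashof L ν (force F L Φ) = L ^ 3 * F * a / ν ^ 2 := by
    have : s * (F * s * a) = s ^ 2 * F * a := by ring
    rw [grashof, rpow_three_halves hL.le, hnorm, ← hs, this, hs2]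
  -- a vanishing force has `Gr = 0`
  rcases (mul_nonneg hF ha0).eq_or_lt with hFa | hFa
  · refine ⟨0, fun T hT _ => ?_⟩
    rw [hGr, mul_assoc, ← hFa, mul_zero, zero_div, zero_div, add_zero]
    have h1 := reynolds_nonneg hL.le hν.le u T
    have h2 : 0 ≤ timeAvg T (fun t => ∫ x in box L, gradSq (φ t) x) :=
      timeAvg_nonneg hT.le fun t => integral_nonneg fun x =>
        Finset.sum_nonneg fun i _ => sq_nonneg _
    positivity
  have hF0 : 0 < F := pos_of_mul_pos_left hFa ha0
  have ha1 : 0 < a := pos_of_mul_pos_right hFa hF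
  have hM : ∀ x ∈ box L, ∀ i j, |pd j (fun y => force F L Φ y i) x| ≤ F * L⁻¹ * K := by
    intro x hx i j
    rw [hΦ.pd_force hL.ne', abs_mul, abs_of_nonneg (by positivity : 0 ≤ F * L⁻¹)]
    refine mul_le_mul_of_nonneg_left (hK _ ⟨fun k => ?_, fun k => ?_⟩ i j) (by positivity)
    · exact mul_nonneg (inv_nonneg.2 hL.le) (hx.1 k)
    · exact (inv_mul_le_one₀ hL).2 (hx.2 k)
  obtain ⟨C, hC⟩ := hsol.exists_l2Sq_force_le hL hν hγ hLam
    (hΦ.smoothPeriodic_force hL.ne') (hΦ.divergence_force hL.ne') (hΦ.integral_force hL) hM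
  refine ⟨C / (F * a * ν ^ 2), fun T hT0 hT => ?_⟩
  have h := hC T hT0 hT
  have hlap : √(l2Sq L fun x i => lap (fun y => force F L Φ y i) x)
      = F * L⁻¹ ^ 2 * s * b := by
    rw [← sqrt_l2Sq_dilate hL (by positivity)]
    congr 2
    funext x i
    exact hΦ.lap_force hL.ne' i x
  have hf2 : l2Sq L (force F L Φ) = F ^ 2 * L ^ 3 * a ^ 2 := by
    rw [← Real.sq_sqrt (l2Sq_nonneg L (force F L Φ)), hnorm, ← hs2]
    ring
  set U := avgVelocity L u T with hU
  have hu1 : √(timeAvg T fun t => l2Sq L (u t)) = s * U := sqrt_timeAvg_eq hL u T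
  have hu2 : timeAvg T (fun t => l2Sq L (u t)) = L ^ 3 * U ^ 2 := by
    rw [← Real.sq_sqrt (timeAvg_nonneg hT0.le fun t => l2Sq_nonneg L (u t)), hu1, ← hs2]
    ring
  rw [hu1, hu2, hlap, hf2] at h
  set G := timeAvg T (fun t => ∫ x in box L, gradSq (φ t) x) with hG
  have e : ν * (F * L⁻¹ ^ 2 * s * b) * (s * U) = ν * F * L * b * U := by
    have : ν * (F * L⁻¹ ^ 2 * s * b) * (s * U) = ν * F * L⁻¹ ^ 2 * b * U * s ^ 2 := by ring
    rw [this, hs2]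
    field_simp
  rw [e] at h
  calc grashof L ν (force F L Φ) = F ^ 2 * L ^ 3 * a ^ 2 / (F * a * ν ^ 2) := by
        rw [hGr]
        field_simp
    _ ≤ (3 * (F * L⁻¹ * K) * (L ^ 3 * U ^ 2) + ν * F * L * b * U
        + 3 * (F * L⁻¹ * K) * (Lam * G) + C / T) / (F * a * ν ^ 2) := by gcongr
    _ = _ := by
        rw [reynolds, ← hU]
        field_simp

/-- If `Gr` dominates its lower order terms, then `Re ≥ 1` and `Gr ≲ Re²`. -/
lemma le_mul_cube_of_large {A B X Gr Re δ Y : ℝ} (hA : 0 ≤ A) (hB : 0 ≤ B) (hX : 0 ≤ X)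
    (hRe : 0 ≤ Re) (hlarge : (12 * (A + B) + 1) * (1 + X) ≤ Gr)
    (hGr : Gr ≤ A * Re ^ 2 + B * Re + 3 * A * X + δ) (hδ : δ ≤ Gr / 4) (hY : Y ≤ Gr * Re + 1) :
    Y ≤ (12 * (A + B) + 1) ^ 4 * Re ^ 3 := by
  have hAX : 0 ≤ A * X := mul_nonneg hA hX
  have hBX : 0 ≤ B * X := mul_nonneg hB hX
  have hexp : (12 * (A + B) + 1) * (1 + X)
      = 12 * A + 12 * B + 1 + 12 * (A * X) + 12 * (B * X) + X := by ring
  rw [hexp] at hlarge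
  have hhalf : Gr ≤ 2 * (A * Re ^ 2 + B * Re) := by linarith
  have hRe1 : 1 ≤ Re := by
    by_contra! hlt
    have h1 : A * Re ^ 2 ≤ A * 1 := mul_le_mul_of_nonneg_left (pow_le_one₀ hRe hlt.le) hA
    have h2 : B * Re ≤ B * 1 := mul_le_mul_of_nonneg_left hlt.le hB
    linarith
  have hGrRe : Gr ≤ 2 * (A + B) * Re ^ 2 := by
    have : B * Re ≤ B * Re ^ 2 :=
      mul_le_mul_of_nonneg_left (le_self_pow₀ hRe1 two_ne_zero) hB
    linarith
  have h1 : Gr * Re ≤ 2 * (A + B) * Re ^ 2 * Re := mul_le_mul_of_nonneg_right hGrRe hRe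
  have h2 : 1 ≤ Re ^ 3 := one_le_pow₀ hRe1
  have h3 : 0 ≤ (A + B) * Re ^ 3 := by positivity
  calc Y ≤ 2 * (A + B) * Re ^ 2 * Re + Re ^ 3 := by linarith
    _ = 2 * ((A + B) * Re ^ 3) + Re ^ 3 := by ring
    _ ≤ 12 * ((A + B) * Re ^ 3) + Re ^ 3 := by linarith
    _ = (12 * (A + B) + 1) * Re ^ 3 := by ring
    _ ≤ (12 * (A + B) + 1) ^ 4 * Re ^ 3 := by
        gcongr
        exact le_self_pow₀ (by linarith) (by norm_num)

/-- The fourth root of the inequality `h`. -/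
lemma mul_rpow_le_of_pow_four_le {L q c r : ℝ} (hL : 0 ≤ L) (hq : 0 ≤ q) (hc : 0 ≤ c)
    (hr : 0 ≤ r) (h : L ^ 4 * q ≤ c ^ 4 * r ^ 3) :
    L * q ^ (1 / 4 : ℝ) ≤ c * r ^ (3 / 4 : ℝ) := by
  have hroot : ∀ y : ℝ, 0 ≤ y → (y ^ 4) ^ (1 / 4 : ℝ) = y := fun y hy => by
    rw [← Real.rpow_natCast, ← Real.rpow_mul hy]
    norm_num
  calc L * q ^ (1 / 4 : ℝ) = (L ^ 4 * q) ^ (1 / 4 : ℝ) := by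
        rw [Real.mul_rpow (by positivity) hq, hroot L hL]
    _ ≤ (c ^ 4 * r ^ 3) ^ (1 / 4 : ℝ) := Real.rpow_le_rpow (by positivity) h (by norm_num)
    _ = c * r ^ (3 / 4 : ℝ) := by
        rw [Real.mul_rpow (by positivity) (by positivity), hroot c hc, ← Real.rpow_natCast,
          ← Real.rpow_mul hr]
        norm_num

end CHNS

theorem mainTheorem2 (Φ : CHNS.Space → CHNS.Space) (hΦ : CHNS.IsShape Φ) :
    ∃ c : ℝ, 0 < c ∧
      ∀ (L ν γ Lam ξ F : ℝ), 0 < L → 0 < ν → 0 < γ → 0 < Lam → 0 < ξ → 0 ≤ F →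
      ∀ (Tmax : EReal) (u : ℝ → CHNS.Space → CHNS.Space) (φ p : ℝ → CHNS.Space → ℝ),
      CHNS.IsSolution L ν γ Lam ξ (CHNS.force F L Φ) Tmax u φ p →
        -- the energy balance
        (∀ t : ℝ, 0 < t → (t : EReal) < Tmax →
          HasDerivAt (CHNS.energy L Lam ξ u φ)
            (-CHNS.dissipation L ν γ Lam ξ u φ t + CHNS.power L (CHNS.force F L Φ) u t) t) ∧
        -- the dissipation rate is finite and bounded by `ν³ L⁻⁴ Gr Re + O(1/T)`
        (∀ T : ℝ, 0 < T → (T : EReal) < Tmax →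
          IntervalIntegrable (CHNS.dissipation L ν γ Lam ξ u φ) MeasureTheory.volume 0 T) ∧
        (∃ C : ℝ, ∀ T : ℝ, 0 < T → (T : EReal) < Tmax →
          CHNS.dissipationRate L ν γ Lam ξ u φ T
            ≤ ν ^ 3 * (L ^ 4)⁻¹ * CHNS.grashof L ν (CHNS.force F L Φ) * CHNS.reynolds L ν u T
              + C / T) ∧
        -- the relation between `Gr` and `Re`
        (∃ C : ℝ, ∀ T : ℝ, 0 < T → (T : EReal) < Tmax →
          CHNS.grashof L ν (CHNS.force F L Φ)
            ≤ c * (CHNS.reynolds L ν u T + CHNS.reynolds L ν u T ^ 2)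
              + c * (CHNS.timeAvg T (CHNS.energy L Lam ξ u φ) / (L * ν ^ 2))
              + C / T) ∧
        -- the bound on the inverse Kolmogorov-like length at large `Gr`
        (c * (1 + Lam * L ^ 2 / (ν ^ 2 * ξ ^ 2)) ≤ CHNS.grashof L ν (CHNS.force F L Φ) →
          ∃ T₀ : ℝ, 0 < T₀ ∧ ∀ T : ℝ, T₀ ≤ T → (T : EReal) < Tmax →
            L * CHNS.invKolmogorov L ν γ Lam ξ u φ T
              ≤ c * CHNS.reynolds L ν u T ^ (3 / 4 : ℝ)) := by
  open CHNS in
  obtain ⟨A, B, hA, hB, hAB⟩ := exists_grashof_le hΦ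
  -- with this `c`, the hypothesis on `Gr` makes `3 A X` at most `Gr / 4` and excludes `Re < 1`
  refine ⟨12 * (A + B) + 1, by positivity, ?_⟩
  intro L ν γ Lam ξ F hL hν hγ hLam hξ hF Tmax u φ p hsol
  obtain ⟨C₁, hC₁⟩ := hAB L ν γ Lam ξ F hL hν hγ hLam hF Tmax u φ p hsol
  have hfc : ∀ i, Continuous (fun x => force F L Φ x i) := fun i =>
    (hΦ.smoothPeriodic_force hL.ne' i).continuous
  set Gr := grashof L ν (force F L Φ) with hGr
  have hmem : ∀ T : ℝ, 0 < T → (T : EReal) < Tmax → T ∈ times Tmax := fun T h0 h => ⟨h0.le, h⟩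
  set C₂ := (L ^ 3)⁻¹ * energy L Lam ξ u φ 0 with hC₂
  have hdiss : ∀ T : ℝ, 0 < T → (T : EReal) < Tmax →
      dissipationRate L ν γ Lam ξ u φ T
        ≤ ν ^ 3 * (L ^ 4)⁻¹ * Gr * reynolds L ν u T + C₂ / T := by
    intro T hT0 hT
    have h := hsol.timeAvg_dissipation_le hL.le hν.le hγ.le hLam.le hfc hT0 (hmem T hT0 hT)
    rw [sqrt_timeAvg_eq hL] at h
    refine (mul_le_mul_of_nonneg_left h (by positivity : 0 ≤ (L ^ 3)⁻¹)).trans_eq ?_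
    rw [hC₂, hGr, grashof, rpow_three_halves hL.le, reynolds]
    field_simp
  refine ⟨fun t h0 ht => hsol.hasDerivAt_energy hL.le hfc ⟨h0, ht⟩,
    fun T h0 hT => hsol.intervalIntegrable_dissipation hL.le hν.le hγ.le hfc (hmem T h0 hT),
    ⟨C₂, hdiss⟩, ⟨C₁, fun T h0 hT => ?_⟩, fun hlarge => ?_⟩
  · have hRe := reynolds_nonneg hL.le hν.le u T
    have hTm := hmem T h0 hT
    have hE0 : 0 ≤ timeAvg T (energy L Lam ξ u φ) :=
      timeAvg_nonneg h0.le fun t => IsSolution.energy_nonneg hLam.le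
    have hG : Lam * timeAvg T (fun t => ∫ x in box L, gradSq (φ t) x)
        ≤ 2 * timeAvg T (energy L Lam ξ u φ) := by
      rw [← timeAvg_const_mul, ← timeAvg_const_mul]
      exact timeAvg_mono h0.le (continuousOn_const.mul (IsSolution.continuousOn_integral
        (G := fun t x => gradSq (φ t) x) hsol.continuousOn_gradSq hTm))
        (continuousOn_const.mul (hsol.continuousOn_energy hTm))
        fun t ht => hsol.integral_gradSq_le_energy hLam.le (Icc_subset_times hTm ht)
    have hq : A * (Lam * timeAvg T (fun t => ∫ x in box L, gradSq (φ t) x) / (L * ν ^ 2))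
        ≤ A * (2 * timeAvg T (energy L Lam ξ u φ) / (L * ν ^ 2)) := by gcongr
    have hE1 : 0 ≤ timeAvg T (energy L Lam ξ u φ) / (L * ν ^ 2) := by positivity
    have hq' : A * (2 * timeAvg T (energy L Lam ξ u φ) / (L * ν ^ 2))
        = 2 * (A * (timeAvg T (energy L Lam ξ u φ) / (L * ν ^ 2))) := by ring
    have := hC₁ T h0 hT
    nlinarith [sq_nonneg (reynolds L ν u T), mul_nonneg hA hRe, mul_nonneg hB hRe, mul_nonneg hB (sq_nonneg (reynolds L ν u T)),
      mul_nonneg hA (sq_nonneg (reynolds L ν u T)), mul_nonneg hA hE1, mul_nonneg hB hE1]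
  · set X := Lam * L ^ 2 / (ν ^ 2 * ξ ^ 2) with hX
    have hX0 : 0 ≤ X := by positivity
    set C₃ := C₁ + A * (Lam * (ξ ^ 2 / (2 * γ * Lam) * ∫ x in box L, φ 0 x ^ 2) / (L * ν ^ 2))
      with hC₃
    have hGr0 : 0 < Gr := lt_of_lt_of_le (by positivity) hlarge
    refine ⟨4 * |C₃| / Gr + L ^ 4 * |C₂| / ν ^ 3 + 1, by positivity, fun T hT₀ hT => ?_⟩
    have hTa : 4 * |C₃| / Gr ≤ T := by
      have : 0 ≤ L ^ 4 * |C₂| / ν ^ 3 := by positivity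
      linarith
    have hTb : L ^ 4 * |C₂| / ν ^ 3 ≤ T := by
      have : 0 ≤ 4 * |C₃| / Gr := by positivity
      linarith
    have h0 : 0 < T := by
      have : 0 ≤ 4 * |C₃| / Gr + L ^ 4 * |C₂| / ν ^ 3 := by positivity
      linarith
    have hRe := reynolds_nonneg hL.le hν.le u T
    set Re := reynolds L ν u T with hRedef
    -- the mean of `Λ ∫ |∇φ|²`, in units of `L ν²`, is at most `3 X` up to `O(1 / T)`
    have hgrad : A * (Lam * timeAvg T (fun t => ∫ x in box L, gradSq (φ t) x) / (L * ν ^ 2))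
        ≤ 3 * A * X
          + A * (Lam * (ξ ^ 2 / (2 * γ * Lam) * ∫ x in box L, φ 0 x ^ 2) / (L * ν ^ 2)) / T := by
      have h := hsol.timeAvg_gradSq_le hL.le hγ hLam hξ h0 (hmem T h0 hT)
      have h1 : A * (Lam * timeAvg T (fun t => ∫ x in box L, gradSq (φ t) x) / (L * ν ^ 2))
          ≤ A * (Lam * (3 * L ^ 3 / ξ ^ 2
            + ξ ^ 2 / (2 * γ * Lam) * (∫ x in box L, φ 0 x ^ 2) / T) / (L * ν ^ 2)) := by gcongr
      refine h1.trans_eq ?_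
      rw [hX]
      field_simp
    have hCT : C₃ / T ≤ Gr / 4 := by
      rw [div_le_iff₀ hGr0] at hTa
      rw [div_le_iff₀ h0]
      linarith [le_abs_self C₃]
    have hC3T : C₃ / T = C₁ / T
        + A * (Lam * (ξ ^ 2 / (2 * γ * Lam) * ∫ x in box L, φ 0 x ^ 2) / (L * ν ^ 2)) / T := by
      rw [hC₃, add_div]
    have hD0 : 0 ≤ dissipationRate L ν γ Lam ξ u φ T :=
      mul_nonneg (by positivity) (timeAvg_nonneg h0.le fun t =>
        IsSolution.dissipation_nonneg hν.le hγ.le)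
    have h1 : L ^ 4 * (dissipationRate L ν γ Lam ξ u φ T / ν ^ 3)
        ≤ Gr * Re + L ^ 4 * C₂ / ν ^ 3 / T := by
      have h2 : L ^ 4 * (dissipationRate L ν γ Lam ξ u φ T / ν ^ 3)
          ≤ L ^ 4 * ((ν ^ 3 * (L ^ 4)⁻¹ * Gr * Re + C₂ / T) / ν ^ 3) := by
        gcongr
        exact hdiss T h0 hT
      refine h2.trans_eq ?_
      field_simp
    have h3 : L ^ 4 * C₂ / ν ^ 3 / T ≤ 1 := by
      rw [div_le_one h0]
      refine le_trans ?_ hTb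
      gcongr
      exact le_abs_self C₂
    have h4 : Gr ≤ A * Re ^ 2 + B * Re + 3 * A * X + C₃ / T := by
      have := hC₁ T h0 hT
      linarith
    exact mul_rpow_le_of_pow_four_le hL.le (by positivity) (by positivity) hRe
      (le_mul_cube_of_large hA hB hX0 hRe hlarge h4 hCT (h1.trans (by linarith)))
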